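/- Let $(\Omega,\mathcal F,\mathbb P)$ be a probability space and let $L^+$ be the set of nonnegative essentially bounded random variables. Let $n\ge 1$ and let $h_1,\dots,h_n$ be distortion functions, i.e. increasing functions $h_i:[0,1]\to[0,1]$ with $h_i(0)=0$ and $h_i(1)=1$. For a function $h$ on $[0,1]$ with $h(0)=0$ write $\tilde h(t)=h(1)-h(1-t)$ for its dual and $$\rho_h(Z)=\int_0^\infty h(\mathbb P(Z\ge x))\,dx+\int_{-\infty}^0\bigl(h(\mathbb P(Z\ge x))-h(1)\bigr)\,dx ,$$ and for functions $f_1,\dots,f_n$ on $[0,1]$ let $$\Bigl(\mathop{\lozenge}_{i=1}^n f_i\Bigr)(x)=\sup\Bigl\{\sum_{i=1}^n f_i(x_i): x_i\in[0,1],\ \sum_{i=1}^n x_i=x\Bigr\}$$ be their sup-convolution. Let $X\in L^+$ be such that there is a random variable uniform on $[0,1]$ and independent of $X$. Let $c:[0,1]\to\mathbb R$ be increasing, convex, continuous, and differentiable on $(0,1)$, and let $W\in\mathbb R$ with $c(0)\le W$ (so that the problem below is feasible). Consider the problem $$\text{minimize } \sum_{i=1}^n\rho_{h_i}(-X_i)\quad\text{subject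 to } \lambda\in[0,1],\ c(\lambda)\le W,\ X_1,\dots,X_n\in L^+,\ X_1+\dots+X_n=W+\lambda X-c(\lambda)\ \text{a.s.}$$ over $(\lambda,X_1,\dots,X_n)$. Call $\lambda$ optimal if it is part of a minimizer. Inverses are the $[0,1]$-valued generalized inverses $f^{-1}(y)=\sup\{t\in(0,1):f(t)\le y\}$, with $\sup\emptyset=0$. (i) If every $h_i$ is concave, then $$\lambda^*=\min\bigl\{(c')^{-1}(\rho_\ell(X)),\ c^{-1}(W)\bigr\}$$ is optimal, where $\ell$ is the dual of $\min_i h_i$, i.e. $\tilde\ell=\min_{i} h_i$. (ii) If every $h_i$ is convex and continuous, then $$\lambda^*=\min\bigl\{(c')^{-1}(\rho_g(X)),\ c^{-1}(W)\bigr\}$$ is optimal, where $g(x)=\bigl(\mathop{\lozenge}_{i=1}^n\tilde h_i\bigr)(x)\big/\bigl(\mathop{\lozenge}_{i=1}^n\tilde h_i\bigr)(1)$ for $x\in[0,1]$. In both cases $\lambda^*$ is the largest optimal proportion, and if $c$ is strictly convex it is the only one. -/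

import Mathlib

open MeasureTheory ProbabilityTheory Set

noncomputable section

namespace PortfolioManager

/-- A distortion function: increasing on `[0,1]` with `h 0 = 0` and `h 1 = 1` (hence with values in
`[0,1]` there). Functions on `[0,1]` are represented by functions on `ℝ`; only their values on
`[0,1]` are ever used. -/
structure IsDistortion (h : ℝ → ℝ) : Prop where
  monotoneOn : MonotoneOn h (Icc 0 1)
  map_zero : h 0 = 0
  map_one : h 1 = 1

/-- The dual `t ↦ h 1 - h (1 - t)` of a function on `[0,1]`. -/
def dual (h : ℝ → ℝ) (t : ℝ) : ℝ := h 1 - h (1 - t)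

/-- The sup-convolution of functions on `[0,1]`. -/
def supConv {n : ℕ} (h : Fin n → ℝ → ℝ) (x : ℝ) : ℝ :=
  sSup {s : ℝ | ∃ y : Fin n → ℝ, (∀ i, y i ∈ Icc (0 : ℝ) 1) ∧ ∑ i, y i = x ∧ s = ∑ i, h i (y i)}

variable {Ω : Type*} [MeasurableSpace Ω]

/-- The distortion riskmetric of `h`, i.e. the Choquet integral of `X` with respect to `h ∘ P`. -/
def riskmetric (P : Measure Ω) (h : ℝ → ℝ) (X : Ω → ℝ) : ℝ :=
  (∫ x in Ioi (0 : ℝ), h (P.real {ω | x ≤ X ω}))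
    + ∫ x in Iio (0 : ℝ), (h (P.real {ω | x ≤ X ω}) - h 1)

/-- The cone of nonnegative essentially bounded random variables. -/
def LPlus (P : Measure Ω) : Set (Ω → ℝ) :=
  {X | MemLp X ⊤ P ∧ 0 ≤ᵐ[P] X}

/-- There is a random variable, uniform on `[0,1]`, that is independent of `X`. -/
def AdmitsIndepUniform (P : Measure Ω) (X : Ω → ℝ) : Prop :=
  ∃ U : Ω → ℝ, Measurable U ∧ pdf.IsUniform U (Icc (0 : ℝ) 1) P volume ∧ IndepFun U X P

/-- Feasible decisions of the portfolio manager: a proportion `t` together with an allocation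
`Y` of the terminal wealth `W + t * X - c t` to the agents. -/
structure IsFeasible (P : Measure Ω) {n : ℕ} (X : Ω → ℝ) (c : ℝ → ℝ) (W : ℝ)
    (t : ℝ) (Y : Fin n → Ω → ℝ) : Prop where
  proportion_mem : t ∈ Icc (0 : ℝ) 1
  cost_le : c t ≤ W
  mem_LPlus : ∀ i, Y i ∈ LPlus P
  sum_eq : (fun ω => ∑ i, Y i ω) =ᵐ[P] fun ω => W + t * X ω - c t

/-- The aggregate risk value of the payoffs `Y` (losses are the negatives of payoffs). -/
def aggregateRisk (P : Measure Ω) {n : ℕ} (h : Fin n → ℝ → ℝ) (Y : Fin n → Ω → ℝ) : ℝ :=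
  ∑ i, riskmetric P (h i) (fun ω => -Y i ω)

/-- The pair `(t, Y)` solves the portfolio manager's problem. -/
def IsSolution (P : Measure Ω) {n : ℕ} (h : Fin n → ℝ → ℝ) (X : Ω → ℝ) (c : ℝ → ℝ) (W : ℝ)
    (t : ℝ) (Y : Fin n → Ω → ℝ) : Prop :=
  IsFeasible P X c W t Y ∧
    ∀ (s : ℝ) (Z : Fin n → Ω → ℝ), IsFeasible P X c W s Z →
      aggregateRisk P h Y ≤ aggregateRisk P h Z

/-- The set of optimal proportions: those that are part of a solution of the problem. -/
def optimalProportions (P : Measure Ω) {n : ℕ} (h : Fin n → ℝ → ℝ) (X : Ω → ℝ) (c : ℝ → ℝ)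
    (W : ℝ) : Set ℝ :=
  {t | ∃ Y : Fin n → Ω → ℝ, IsSolution P h X c W t Y}

/-- The inverse, with values in `[0,1]`, of an increasing function `f` on `(0,1)`, that is
`sup {t ∈ (0,1) | f t ≤ y}`, where the supremum over the empty set is `0`. -/
def unitInv (f : ℝ → ℝ) (y : ℝ) : ℝ :=
  sSup (insert 0 {t : ℝ | t ∈ Ioo (0 : ℝ) 1 ∧ f t ≤ y})

/-- The candidate `min {c'⁻¹(ρ_g(X)), c⁻¹(W)}`. -/
def proportion (P : Measure Ω) (g : ℝ → ℝ) (X : Ω → ℝ) (c : ℝ → ℝ) (W : ℝ) : ℝ :=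
  min (unitInv (deriv c) (riskmetric P g X)) (unitInv c W)

end PortfolioManager

end

/-! For `Y ≥ 0` the riskmetric of `-Y` under `h` is minus the Choquet integral of `Y` under `dual h`
(`riskmetric_neg_eq`), so the manager maximizes a sum of Choquet integrals. Suppose that for some
`K` the best allocation of any wealth profile `Z = a + t * X` has aggregate value `choquet P K Z`.
By translation and positive homogeneity (`choquet_add_mul`) this equals `K 1 * (a + t * r)`, with
`r` the riskmetric of `X` under `K / K 1`. For `a = W - c t` there remains the maximization of the
concave function `t * r - c t` subject to `c t ≤ W` (`optimalProportions_eq_of_choquet`). It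
increases while `c' ≤ r` and then strictly decreases, whence the formula
(`isGreatest_netGainMaximizers`).

It remains to find `K`. If every `h i` is concave, `K` is the maximum of the convex duals. It is
convex, hence its Choquet integral is superadditive, which gives the upper bound
(`sum_choquet_le_of_convexOn`). The bound is attained by paying each layer `dy` of `Z` to an agent
whose dual is largest at `P(Z ≥ y)` (`exists_allocation_of_max`).

If every `h i` is convex, `K` is the sup-convolution of the concave duals. The upper bound follows
by linearizing `K` along supergradients, whose slopes increase with the level
(`sum_choquet_le_supConv`). It is attained by giving all of `Z` to one randomly selected agent, so
that the tails of the shares split the tail of `Z` optimally at every level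
(`exists_allocation_of_supConv`); the selection uses the independent uniform variable. -/

noncomputable section

namespace PortfolioManager

/-! ### Choquet integrals: reduction of the riskmetric, affine transformations. -/

section ChoquetBasics

variable {Ω : Type*} [MeasurableSpace Ω]

/-- The Choquet integral of a nonnegative random variable with respect to `k ∘ P`. -/
def choquet (P : Measure Ω) (k : ℝ → ℝ) (Z : Ω → ℝ) : ℝ :=
  ∫ y in Ioi (0 : ℝ), k (P.real {ω | y ≤ Z ω})

theorem measureReal_ge_congr {P : Measure Ω} {Y Z : Ω → ℝ} (hYZ : Y =ᵐ[P] Z) (y : ℝ) :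
    P.real {ω | y ≤ Y ω} = P.real {ω | y ≤ Z ω} := by
  apply measureReal_congr
  filter_upwards [hYZ] with ω hω
  exact propext (by simp [hω] : ω ∈ {ω | y ≤ Y ω} ↔ ω ∈ {ω | y ≤ Z ω})

theorem choquet_congr {P : Measure Ω} {Y Z : Ω → ℝ} (hYZ : Y =ᵐ[P] Z) (k : ℝ → ℝ) :
    choquet P k Y = choquet P k Z := by
  simp only [choquet, measureReal_ge_congr hYZ]

theorem riskmetric_congr {P : Measure Ω} {Y Z : Ω → ℝ} (hYZ : Y =ᵐ[P] Z) (k : ℝ → ℝ) :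
    riskmetric P k Y = riskmetric P k Z := by
  simp only [riskmetric, measureReal_ge_congr hYZ]

theorem choquet_div_const (P : Measure Ω) (k : ℝ → ℝ) (b : ℝ) (Z : Ω → ℝ) :
    choquet P (fun x => k x / b) Z = choquet P k Z / b := by
  simp only [choquet, integral_div]

theorem comp_measureReal_ge_eq_zero {P : Measure Ω} {k : ℝ → ℝ} {Z : Ω → ℝ} {M : ℝ}
    (hk0 : k 0 = 0) (hZM : ∀ ω, Z ω ≤ M) {y : ℝ} (hy : M < y) :
    k (P.real {ω | y ≤ Z ω}) = 0 := by
  have : {ω | y ≤ Z ω} = ∅ := by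
    ext ω; simpa using (hZM ω).trans_lt hy
  simp [this, hk0]

theorem choquet_eq_setIntegral {P : Measure Ω} {k : ℝ → ℝ} {Z : Ω → ℝ} {M : ℝ}
    (hk0 : k 0 = 0) (hZM : ∀ ω, Z ω ≤ M) :
    choquet P k Z = ∫ y in Ioc 0 M, k (P.real {ω | y ≤ Z ω}) := by
  refine setIntegral_eq_of_subset_of_forall_sdiff_eq_zero measurableSet_Ioi (fun y hy => hy.1) ?_
  intro y hy
  apply comp_measureReal_ge_eq_zero hk0 hZM
  by_contra! h
  exact hy.2 ⟨hy.1, h⟩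

theorem choquet_eq_intervalIntegral {P : Measure Ω} {k : ℝ → ℝ} {Z : Ω → ℝ} {M : ℝ}
    (hk0 : k 0 = 0) (hM : 0 ≤ M) (hZM : ∀ ω, Z ω ≤ M) :
    choquet P k Z = ∫ y in (0 : ℝ)..M, k (P.real {ω | y ≤ Z ω}) := by
  rw [choquet_eq_setIntegral hk0 hZM, intervalIntegral.integral_of_le hM]

section Probability

variable {P : Measure Ω} [IsProbabilityMeasure P] {k : ℝ → ℝ} {Z : Ω → ℝ} {M : ℝ}

theorem measureReal_ge_mem (P : Measure Ω) [IsProbabilityMeasure P] (Z : Ω → ℝ) (y : ℝ) :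
    P.real {ω | y ≤ Z ω} ∈ Icc (0 : ℝ) 1 :=
  ⟨measureReal_nonneg, measureReal_le_one⟩

theorem antitone_measureReal_ge (P : Measure Ω) [IsProbabilityMeasure P] (Z : Ω → ℝ) :
    Antitone fun y => P.real {ω | y ≤ Z ω} := fun _ _ hab =>
  measureReal_mono fun _ hω => le_trans hab hω

theorem antitone_comp_measureReal_ge (hk : MonotoneOn k (Icc 0 1)) (Z : Ω → ℝ) :
    Antitone fun y => k (P.real {ω | y ≤ Z ω}) := fun _ _ hab =>
  hk (measureReal_ge_mem P Z _) (measureReal_ge_mem P Z _) (antitone_measureReal_ge P Z hab)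

theorem integrableOn_comp_measureReal_ge (hk : MonotoneOn k (Icc 0 1)) (Z : Ω → ℝ) (a b : ℝ) :
    IntegrableOn (fun y => k (P.real {ω | y ≤ Z ω})) (Ioc a b) :=
  (((antitone_comp_measureReal_ge hk Z).antitoneOn _).integrableOn_isCompact
    isCompact_Icc).mono_set Ioc_subset_Icc_self

theorem riskmetric_eq_choquet (hZ0 : ∀ ω, 0 ≤ Z ω) : riskmetric P k Z = choquet P k Z := by
  rw [riskmetric, choquet, add_eq_left]
  apply setIntegral_eq_zero_of_forall_eq_zero
  intro x hx
  have : {ω | x ≤ Z ω} = univ := eq_univ_of_forall fun ω => (le_of_lt hx).trans (hZ0 ω)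
  simp [this]

theorem riskmetric_neg_eq {h : ℝ → ℝ} (h0 : h 0 = 0) (hZ : Measurable Z) (hZ0 : ∀ ω, 0 ≤ Z ω) :
    riskmetric P h (fun ω => -Z ω) = -choquet P (dual h) Z := by
  have h1 : ∫ x in Ioi (0 : ℝ), h (P.real {ω | x ≤ -Z ω}) = 0 := by
    apply setIntegral_eq_zero_of_forall_eq_zero
    intro x hx
    have : {ω | x ≤ -Z ω} = ∅ := by
      ext ω
      have := hZ0 ω
      have hx' : 0 < x := hx
      simp only [mem_ofPred_eq, mem_empty_iff_false, iff_false, not_le]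
      linarith
    simp [this, h0]
  rw [riskmetric, h1, zero_add, choquet, ← integral_neg, ← integral_Iic_eq_integral_Iio]
  have hsub := integral_comp_neg_Ioi 0 fun x => h (P.real {ω | x ≤ -Z ω}) - h 1
  rw [neg_zero] at hsub
  rw [← hsub]
  apply integral_congr_ae
  -- Complementation produces the strict tail; it differs from the weak one only on a null set of
  -- levels.
  have hae := (meas_le_ae_eq_meas_lt P (volume.restrict (Ioi (0 : ℝ))) Z)
  filter_upwards [hae] with y hy
  have hc : {ω | -y ≤ -Z ω} = {ω | y < Z ω}ᶜ := by
    ext ω; simp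
  have hy' : P.real {ω | y < Z ω} = P.real {ω | y ≤ Z ω} := by
    simp only [measureReal_def, hy]
  rw [hc, probReal_compl_eq_one_sub (measurableSet_lt measurable_const hZ), hy', dual]
  ring

/-- Levels up to `a` have probability one and contribute `a * k 1`; above `a`, substitute `y ↦ a + t
* y`. -/
theorem choquet_add_mul (hk : MonotoneOn k (Icc 0 1)) (hk0 : k 0 = 0) (hZ0 : ∀ ω, 0 ≤ Z ω)
    (hZM : ∀ ω, Z ω ≤ M) {a t : ℝ} (ha : 0 ≤ a) (ht : 0 ≤ t) :
    choquet P k (fun ω => a + t * Z ω) = a * k 1 + t * choquet P k Z := by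
  have hM : 0 ≤ M := by
    obtain ⟨ω⟩ : Nonempty Ω := P.nonempty_of_neZero
    exact (hZ0 ω).trans (hZM ω)
  have hb : ∀ ω, a + t * Z ω ≤ a + t * M := fun ω => by
    have := mul_le_mul_of_nonneg_left (hZM ω) ht
    linarith
  have htM : 0 ≤ t * M := mul_nonneg ht hM
  have hint := fun u v : ℝ => (antitone_comp_measureReal_ge (P := P) hk
    (fun ω => a + t * Z ω)).intervalIntegrable (μ := volume) (a := u) (b := v)
  rw [choquet_eq_intervalIntegral hk0 (by positivity) hb,
    ← intervalIntegral.integral_add_adjacent_intervals (hint 0 a) (hint a _)]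
  congr 1
  · have : ∀ y ∈ uIcc 0 a, k (P.real {ω | y ≤ a + t * Z ω}) = k 1 := by
      intro y hy
      rw [uIcc_of_le ha] at hy
      have : {ω | y ≤ a + t * Z ω} = univ := eq_univ_of_forall fun ω => by
        have := mul_nonneg ht (hZ0 ω)
        have := hy.2
        simp only [mem_ofPred_eq]
        linarith
      simp [this]
    rw [intervalIntegral.integral_congr this]
    simp
  · rcases ht.eq_or_lt with rfl | ht'
    · simp
    rw [choquet_eq_intervalIntegral hk0 hM hZM]
    have := intervalIntegral.mul_integral_comp_add_mul (a := 0) (b := M)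
      (f := fun y => k (P.real {ω | y ≤ a + t * Z ω})) t a
    simp only [mul_zero, add_zero] at this
    rw [← this]
    congr 1
    apply intervalIntegral.integral_congr
    intro y _
    simp only [add_le_add_iff_left, mul_le_mul_iff_right₀ ht']

end Probability

end ChoquetBasics

/-! ### Superadditivity of Choquet integrals under convex distortions. -/

section Superadditivity

variable {Ω : Type*}

/-- The number of sets `A a`, `a ∈ s`, that contain a given point. -/
def coverCount {ι : Type*} (A : ι → Set Ω) (s : Finset ι) (ω : Ω) : ℕ :=
  ∑ a ∈ s, (A a).indicator (fun _ => 1) ω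

theorem measurable_coverCount [MeasurableSpace Ω] {ι : Type*} {A : ι → Set Ω} (hA : ∀ a, MeasurableSet (A a))
    (s : Finset ι) : Measurable (coverCount A s) :=
  Finset.measurable_fun_sum _ fun a _ => measurable_const.indicator (hA a)

theorem coverCount_le_card {ι : Type*} (A : ι → Set Ω) (s : Finset ι) (ω : Ω) :
    coverCount A s ω ≤ s.card := by
  rw [Finset.card_eq_sum_ones]
  exact Finset.sum_le_sum fun a _ => indicator_le_self' (fun _ _ => Nat.zero_le _) ω

/-- A supermodular set function increases when a family of sets is replaced by the chain of its
multiplicity level sets. -/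
theorem sum_le_sum_coverCount_of_supermodular [MeasurableSpace Ω] {ι : Type*} [DecidableEq ι] {ν : Set Ω → ℝ}
    (hν0 : ν ∅ = 0)
    (hν : ∀ A B, MeasurableSet A → MeasurableSet B → ν A + ν B ≤ ν (A ∪ B) + ν (A ∩ B))
    {A : ι → Set Ω} (hA : ∀ a, MeasurableSet (A a)) (s : Finset ι) :
    ∑ a ∈ s, ν (A a) ≤ ∑ k ∈ Finset.range s.card, ν {ω | k + 1 ≤ coverCount A s ω} := by
  induction s using Finset.induction_on with
  | empty => simp
  | insert b s hb ih =>
    -- After inserting `b`, the level set at `k + 1` is `D (k + 1) ∪ (A b ∩ D k)`, and these two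
    -- sets meet in `A b ∩ D (k + 1)`. Supermodularity leaves a sum telescoping from `ν (A b)` down
    -- to `ν ∅ = 0`.
    set D : ℕ → Set Ω := fun k => {ω | k ≤ coverCount A s ω} with hD
    have hDm : ∀ k, MeasurableSet (D k) := fun k =>
      measurableSet_le measurable_const (measurable_coverCount hA s)
    have hlast : D (s.card + 1) = ∅ := by
      ext ω
      have := coverCount_le_card A s ω
      simp only [hD, mem_ofPred_eq, mem_empty_iff_false, iff_false]
      omega
    have hins : ∀ k, {ω | k + 1 ≤ coverCount A (insert b s) ω} = D (k + 1) ∪ (A b ∩ D k) := by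
      intro k
      ext ω
      simp only [coverCount, Finset.sum_insert hb, hD, mem_ofPred_eq, mem_union, mem_inter_iff]
      by_cases hω : ω ∈ A b
      · simp only [hω, indicator_of_mem, true_and]
        omega
      · simp only [hω, not_false_eq_true, indicator_of_notMem, false_and, or_false, zero_add]
    have hinter : ∀ k, D (k + 1) ∩ (A b ∩ D k) = A b ∩ D (k + 1) := by
      intro k
      ext ω
      simp only [hD, mem_ofPred_eq, mem_inter_iff]
      constructor
      · tauto
      · rintro ⟨h1, h2⟩
        exact ⟨h2, h1, by omega⟩
    have key : ∀ k, ν (D (k + 1)) + (ν (A b ∩ D k) - ν (A b ∩ D (k + 1)))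
        ≤ ν {ω | k + 1 ≤ coverCount A (insert b s) ω} := by
      intro k
      have := hν (D (k + 1)) (A b ∩ D k) (hDm _) ((hA b).inter (hDm k))
      rw [hinter, ← hins] at this
      linarith
    rw [Finset.sum_insert hb, Finset.card_insert_of_notMem hb]
    refine le_trans ?_ (Finset.sum_le_sum fun k _ => key k)
    rw [Finset.sum_add_distrib, Finset.sum_range_sub', Finset.sum_range_succ, hlast]
    have h0 : A b ∩ D 0 = A b := by
      ext ω; simp [hD]
    rw [h0, inter_empty, hν0]
    have := ih
    simp only [hD] at this ⊢
    linarith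

section Superadditive

variable [MeasurableSpace Ω] {P : Measure Ω} [IsProbabilityMeasure P] {l : ℝ → ℝ}

/-- The probabilities of `A` and `B` lie between those of intersection and union and have the same
sum, so their chord coefficients are complementary. -/
theorem supermodular_of_convexOn (hl : ConvexOn ℝ (Icc 0 1) l)
    {A B : Set Ω} (hB : MeasurableSet B) :
    l (P.real A) + l (P.real B) ≤ l (P.real (A ∪ B)) + l (P.real (A ∩ B)) := by
  have hsum := measureReal_union_add_inter (μ := P) (s := A) hB
  set a := P.real A
  set b := P.real B
  set u := P.real (A ∪ B)
  set v := P.real (A ∩ B)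
  have hva : v ≤ a := measureReal_mono inter_subset_left
  have hvb : v ≤ b := measureReal_mono inter_subset_right
  have hu : u ∈ Icc (0 : ℝ) 1 := ⟨measureReal_nonneg, measureReal_le_one⟩
  have hv : v ∈ Icc (0 : ℝ) 1 := ⟨measureReal_nonneg, measureReal_le_one⟩
  rcases (hva.trans (by linarith : a ≤ u)).eq_or_lt with huv | huv
  · have : a = u := by linarith
    have : b = v := by linarith
    simp [*]
  · have h1 := hl.2 hv hu
      (div_nonneg (by linarith) (by linarith) : 0 ≤ (u - a) / (u - v))
      (div_nonneg (by linarith) (by linarith) : 0 ≤ (a - v) / (u - v))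
      (by rw [← add_div]; exact (div_eq_one_iff_eq (by linarith)).2 (by ring))
    have h2 := hl.2 hv hu
      (div_nonneg (by linarith) (by linarith) : 0 ≤ (u - b) / (u - v))
      (div_nonneg (by linarith) (by linarith) : 0 ≤ (b - v) / (u - v))
      (by rw [← add_div]; exact (div_eq_one_iff_eq (by linarith)).2 (by ring))
    have hne : u - v ≠ 0 := by linarith
    have e1 : ((u - a) / (u - v)) • v + ((a - v) / (u - v)) • u = a := by
      simp only [smul_eq_mul]; field_simp; ring
    have e2 : ((u - b) / (u - v)) • v + ((b - v) / (u - v)) • u = b := by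
      simp only [smul_eq_mul]; field_simp; ring
    rw [e1] at h1
    rw [e2] at h2
    simp only [smul_eq_mul] at h1 h2
    have hb' : b = u + v - a := by linarith
    have e3 : (u - a) / (u - v) + (u - b) / (u - v) = 1 := by
      rw [← add_div]; exact (div_eq_one_iff_eq hne).2 (by linarith)
    have e4 : (a - v) / (u - v) + (b - v) / (u - v) = 1 := by
      rw [← add_div]; exact (div_eq_one_iff_eq hne).2 (by linarith)
    calc l a + l b ≤ ((u - a) / (u - v) + (u - b) / (u - v)) * l v
          + ((a - v) / (u - v) + (b - v) / (u - v)) * l u := by linarith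
      _ = l u + l v := by rw [e3, e4]; ring

theorem choquet_le_sum (hlm : MonotoneOn l (Icc 0 1)) (hl0 : l 0 = 0) {Z : Ω → ℝ} {J : ℕ}
    (hZ : ∀ ω, Z ω ≤ J) :
    choquet P l Z ≤ ∑ j ∈ Finset.range J, l (P.real {ω | (j : ℝ) ≤ Z ω}) := by
  rw [choquet_eq_intervalIntegral hl0 (Nat.cast_nonneg J) hZ]
  have := AntitoneOn.integral_le_sum (x₀ := 0) (a := J)
    ((antitone_comp_measureReal_ge (P := P) hlm Z).antitoneOn _)
  simpa using this

theorem sum_le_choquet (hlm : MonotoneOn l (Icc 0 1)) (hl0 : l 0 = 0) {Z : Ω → ℝ} {J : ℕ}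
    (hZ : ∀ ω, Z ω ≤ J) :
    ∑ j ∈ Finset.range J, l (P.real {ω | (j : ℝ) + 1 ≤ Z ω}) ≤ choquet P l Z := by
  rw [choquet_eq_intervalIntegral hl0 (Nat.cast_nonneg J) hZ]
  have := AntitoneOn.sum_le_integral (x₀ := 0) (a := J)
    ((antitone_comp_measureReal_ge (P := P) hlm Z).antitoneOn _)
  simpa using this

theorem card_filter_natCast_le {J : ℕ} {x : ℝ} (hx : 0 ≤ x) :
    (((Finset.range J).filter fun j : ℕ => (j : ℝ) ≤ x).card : ℝ) ≤ x + 1 := by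
  have hsub : ((Finset.range J).filter fun j : ℕ => (j : ℝ) ≤ x) ⊆
      Finset.range (⌊x⌋₊ + 1) := by
    intro j hj
    simp only [Finset.mem_filter, Finset.mem_range] at hj ⊢
    exact Nat.lt_succ_of_le (Nat.le_floor hj.2)
  have := Finset.card_le_card hsub
  rw [Finset.card_range] at this
  calc _ ≤ ((⌊x⌋₊ + 1 : ℕ) : ℝ) := by exact_mod_cast this
    _ ≤ x + 1 := by push_cast; linarith [Nat.floor_le hx]

/-- Superadditivity up to a discretization error. Only integer levels are used: the sets `{j ≤ Y i}`
cover `ω` at most `∑ i, (Y i ω + 1)` times, so discarding the first `n` multiplicity levels costs at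
most `n`, however large the `Y i` are. -/
theorem sum_choquet_le_add {n : ℕ} (hlc : ConvexOn ℝ (Icc 0 1) l)
    (hlm : MonotoneOn l (Icc 0 1)) (hl0 : l 0 = 0) (hl1 : l 1 = 1) {Y : Fin n → Ω → ℝ}
    {J : ℕ} (hYm : ∀ i, Measurable (Y i)) (hY0 : ∀ i ω, 0 ≤ Y i ω) (hYJ : ∀ i ω, Y i ω ≤ J) :
    ∑ i, choquet P l (Y i) ≤ choquet P l (fun ω => ∑ i, Y i ω) + n := by
  set A : Fin n × ℕ → Set Ω := fun a => {ω | (a.2 : ℝ) ≤ Y a.1 ω} with hA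
  have hAm : ∀ a, MeasurableSet (A a) := fun a => measurableSet_le measurable_const (hYm a.1)
  set s : Finset (Fin n × ℕ) := Finset.univ ×ˢ Finset.range J with hs
  have hcard : s.card = n * J := by simp [hs]
  set Z : Ω → ℝ := fun ω => ∑ i, Y i ω with hZ
  have hcount : ∀ ω, (coverCount A s ω : ℝ) ≤ Z ω + n := by
    intro ω
    have h1 : (coverCount A s ω : ℝ) =
        ∑ i, (((Finset.range J).filter fun j : ℕ => (j : ℝ) ≤ Y i ω).card : ℝ) := by
      simp only [coverCount, hs, Finset.sum_product, Nat.cast_sum, Finset.card_filter]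
      refine Finset.sum_congr rfl fun i _ => Finset.sum_congr rfl fun j _ => ?_
      by_cases h : (j : ℝ) ≤ Y i ω <;> simp [hA, indicator, h]
    rw [h1]
    calc _ ≤ ∑ i, (Y i ω + 1) :=
          Finset.sum_le_sum fun i _ => card_filter_natCast_le (hY0 i ω)
      _ = Z ω + n := by simp [Finset.sum_add_distrib, hZ]
  have hZJ : ∀ ω, Z ω ≤ ((n * J : ℕ) : ℝ) := by
    intro ω
    calc Z ω ≤ ∑ _i : Fin n, (J : ℝ) := Finset.sum_le_sum fun i _ => hYJ i ω
      _ = _ := by simp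
  have hbound : ∀ B : Set Ω, l (P.real B) ∈ Icc (0 : ℝ) 1 := fun B => by
    have hB : P.real B ∈ Icc (0 : ℝ) 1 := ⟨measureReal_nonneg, measureReal_le_one⟩
    constructor
    · rw [← hl0]; exact hlm ⟨le_rfl, zero_le_one⟩ hB hB.1
    · rw [← hl1]; exact hlm hB ⟨zero_le_one, le_rfl⟩ hB.2
  calc ∑ i, choquet P l (Y i) ≤ ∑ i, ∑ j ∈ Finset.range J, l (P.real (A (i, j))) :=
        Finset.sum_le_sum fun i _ => choquet_le_sum hlm hl0 (hYJ i)
    _ = ∑ a ∈ s, l (P.real (A a)) := by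
        rw [hs, Finset.sum_product]
    _ ≤ ∑ k ∈ Finset.range s.card, l (P.real {ω | k + 1 ≤ coverCount A s ω}) :=
        sum_le_sum_coverCount_of_supermodular (ν := fun B => l (P.real B)) (by simp [hl0])
          (fun _ _ _ hB => supermodular_of_convexOn hlc hB) hAm s
    _ ≤ ∑ k ∈ Finset.range (n + n * J), l (P.real {ω | k + 1 ≤ coverCount A s ω}) := by
        rw [hcard]
        exact Finset.sum_le_sum_of_subset_of_nonneg (Finset.range_mono (by omega))
          fun k _ _ => (hbound _).1
    _ ≤ n + ∑ k ∈ Finset.range (n * J), l (P.real {ω | (k : ℝ) + 1 ≤ Z ω}) := by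
        rw [Finset.sum_range_add]
        refine add_le_add ?_ (Finset.sum_le_sum fun k _ => ?_)
        · calc _ ≤ ∑ _k ∈ Finset.range n, (1 : ℝ) :=
                Finset.sum_le_sum fun k _ => (hbound _).2
            _ = n := by simp
        · refine hlm ⟨measureReal_nonneg, measureReal_le_one⟩
            ⟨measureReal_nonneg, measureReal_le_one⟩ (measureReal_mono fun ω hω => ?_)
          have h1 : ((n + k + 1 : ℕ) : ℝ) ≤ coverCount A s ω := by exact_mod_cast hω
          have h2 := hcount ω
          push_cast at h1
          simp only [mem_ofPred_eq]
          linarith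
    _ ≤ choquet P l Z + n := by
        have := sum_le_choquet (P := P) hlm hl0 hZJ
        linarith

/-- Choquet integrals with respect to convex distortions are superadditive. -/
theorem sum_choquet_le_of_convexOn {n : ℕ} (hlc : ConvexOn ℝ (Icc 0 1) l)
    (hlm : MonotoneOn l (Icc 0 1)) (hl0 : l 0 = 0) (hl1 : l 1 = 1) {Y : Fin n → Ω → ℝ}
    {M : ℝ} (hYm : ∀ i, Measurable (Y i)) (hY0 : ∀ i ω, 0 ≤ Y i ω) (hYM : ∀ i ω, Y i ω ≤ M) :
    ∑ i, choquet P l (Y i) ≤ choquet P l (fun ω => ∑ i, Y i ω) := by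
  set a := ∑ i, choquet P l (Y i)
  set b := choquet P l (fun ω => ∑ i, Y i ω) with hb
  -- Both sides are homogeneous, so applying the discretized bound to `N * Y i` makes the error `n`
  -- negligible as `N` grows.
  have key : ∀ N : ℕ, N * a ≤ N * b + n := by
    intro N
    obtain ⟨J, hJ⟩ := exists_nat_ge (N * M)
    have hN : (0 : ℝ) ≤ N := Nat.cast_nonneg N
    have h := sum_choquet_le_add (P := P) hlc hlm hl0 hl1 (Y := fun i ω => N * Y i ω) (J := J)
      (fun i => (hYm i).const_mul _) (fun i ω => mul_nonneg hN (hY0 i ω))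
      (fun i ω => (mul_le_mul_of_nonneg_left (hYM i ω) hN).trans hJ)
    have h1 : ∀ i, choquet P l (fun ω => N * Y i ω) = N * choquet P l (Y i) := fun i => by
      simpa using choquet_add_mul (P := P) hlm hl0 (hY0 i) (hYM i) le_rfl hN
    have h2 : choquet P l (fun ω => ∑ i, N * Y i ω) = N * b := by
      have hs : ∀ ω, ∑ i, Y i ω ≤ ∑ _i : Fin n, M := fun ω =>
        Finset.sum_le_sum fun i _ => hYM i ω
      simpa [Finset.mul_sum] using choquet_add_mul (P := P) hlm hl0
        (fun ω => Finset.sum_nonneg fun i _ => hY0 i ω) hs le_rfl hN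
    rwa [h2, Finset.sum_congr rfl fun i _ => h1 i, ← Finset.mul_sum] at h
  by_contra! hlt
  obtain ⟨N, hN⟩ := exists_nat_gt (n / (a - b))
  rw [div_lt_iff₀ (by linarith)] at hN
  have := key N
  linarith

end Superadditive

end Superadditivity

/-! ### Sup-convolution of concave functions, monotone optimal splits, supergradients. -/

section SupConvolution

/-- The ways to split `x` into `n` numbers of the unit interval. -/
def splits (n : ℕ) (x : ℝ) : Set (Fin n → ℝ) :=
  {y | (∀ i, y i ∈ Icc (0 : ℝ) 1) ∧ ∑ i, y i = x}

/-- The splits of `x` at which the sup-convolution of `k` is attained. -/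
def optimalSplits {n : ℕ} (k : Fin n → ℝ → ℝ) (x : ℝ) : Set (Fin n → ℝ) :=
  {y | y ∈ splits n x ∧ ∀ z ∈ splits n x, ∑ i, k i (z i) ≤ ∑ i, k i (y i)}

variable {n : ℕ} {k : Fin n → ℝ → ℝ}

theorem isCompact_splits (n : ℕ) (x : ℝ) : IsCompact (splits n x) := by
  have h1 : splits n x = (univ.pi fun _ => Icc (0 : ℝ) 1) ∩ {y | ∑ i, y i = x} := by
    ext y
    simp only [splits, mem_ofPred_eq, mem_inter_iff, mem_univ_pi]
  rw [h1]
  exact (isCompact_univ_pi fun _ => isCompact_Icc).inter_right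
    (isClosed_eq (by fun_prop) continuous_const)

theorem splits_nonempty (hn : 1 ≤ n) {x : ℝ} (hx : x ∈ Icc (0 : ℝ) n) : (splits n x).Nonempty := by
  have hn' : (0 : ℝ) < n := by exact_mod_cast hn
  refine ⟨fun _ => x / n, fun _ => ⟨div_nonneg hx.1 hn'.le, (div_le_one hn').2 hx.2⟩, ?_⟩
  simp only [Finset.sum_const, Finset.card_univ, Fintype.card_fin, nsmul_eq_mul]
  field_simp

theorem continuousOn_sum_splits (hk : ∀ i, ContinuousOn (k i) (Icc 0 1)) (x : ℝ) :
    ContinuousOn (fun y : Fin n → ℝ => ∑ i, k i (y i)) (splits n x) :=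
  continuousOn_finsetSum _ fun i _ =>
    (hk i).comp (continuous_apply i).continuousOn fun _ hy => hy.1 i

theorem optimalSplits_nonempty (hn : 1 ≤ n) (hk : ∀ i, ContinuousOn (k i) (Icc 0 1)) {x : ℝ}
    (hx : x ∈ Icc (0 : ℝ) n) : (optimalSplits k x).Nonempty := by
  obtain ⟨y, hy, hmax⟩ := (isCompact_splits n x).exists_isMaxOn (splits_nonempty hn hx)
    (continuousOn_sum_splits hk x)
  exact ⟨y, hy, fun z hz => hmax hz⟩

theorem isCompact_optimalSplits (hn : 1 ≤ n) (hk : ∀ i, ContinuousOn (k i) (Icc 0 1)) {x : ℝ}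
    (hx : x ∈ Icc (0 : ℝ) n) : IsCompact (optimalSplits k x) := by
  obtain ⟨y, hy⟩ := optimalSplits_nonempty hn hk hx
  have h1 : optimalSplits k x =
      splits n x ∩ (fun z : Fin n → ℝ => ∑ i, k i (z i)) ⁻¹' Ici (∑ i, k i (y i)) := by
    ext z
    exact ⟨fun hz => ⟨hz.1, hz.2 y hy.1⟩, fun hz => ⟨hz.1, fun u hu => (hy.2 u hu).trans hz.2⟩⟩
  rw [h1]
  exact (isCompact_splits n x).of_isClosed_subset
    ((continuousOn_sum_splits hk x).preimage_isClosed_of_isClosed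
      (isCompact_splits n x).isClosed isClosed_Ici) inter_subset_left

theorem supConv_eq_of_mem {x : ℝ} {y : Fin n → ℝ} (hy : y ∈ optimalSplits k x) :
    supConv k x = ∑ i, k i (y i) := by
  refine IsGreatest.csSup_eq ⟨⟨y, hy.1.1, hy.1.2, rfl⟩, ?_⟩
  rintro _ ⟨z, hz, hzx, rfl⟩
  exact hy.2 z ⟨hz, hzx⟩

theorem sum_le_supConv (hn : 1 ≤ n) (hk : ∀ i, ContinuousOn (k i) (Icc 0 1)) {z : Fin n → ℝ}
    (hz : ∀ i, z i ∈ Icc (0 : ℝ) 1) : ∑ i, k i (z i) ≤ supConv k (∑ i, z i) := by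
  have hx : ∑ i, z i ∈ Icc (0 : ℝ) n := by
    refine ⟨Finset.sum_nonneg fun i _ => (hz i).1, ?_⟩
    calc ∑ i, z i ≤ ∑ _i : Fin n, (1 : ℝ) := Finset.sum_le_sum fun i _ => (hz i).2
      _ = n := by simp
  obtain ⟨y, hy⟩ := optimalSplits_nonempty hn hk hx
  rw [supConv_eq_of_mem hy]
  exact hy.2 z ⟨hz, rfl⟩

/-- The optimal splits of least Euclidean norm. -/
def minimalSplits (k : Fin n → ℝ → ℝ) (x : ℝ) : Set (Fin n → ℝ) :=
  {y | y ∈ optimalSplits k x ∧ ∀ z ∈ optimalSplits k x, ∑ i, y i ^ 2 ≤ ∑ i, z i ^ 2}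

theorem minimalSplits_nonempty (hn : 1 ≤ n) (hk : ∀ i, ContinuousOn (k i) (Icc 0 1)) {x : ℝ}
    (hx : x ∈ Icc (0 : ℝ) n) : (minimalSplits k x).Nonempty := by
  obtain ⟨y, hy, hmin⟩ := (isCompact_optimalSplits hn hk hx).exists_isMinOn
    (optimalSplits_nonempty hn hk hx)
    (f := fun y : Fin n → ℝ => ∑ i, y i ^ 2) (by fun_prop)
  exact ⟨y, hy, fun z hz => hmin hz⟩

/-- The new points stay in `[a, b]` with the same sum, so their chord coefficients are swapped. This
drives the exchange argument for optimal splits. -/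
theorem add_le_add_of_concaveOn {f : ℝ → ℝ} {s : Set ℝ} (hf : ConcaveOn ℝ s f) {a b δ : ℝ}
    (ha : a ∈ s) (hb : b ∈ s) (hδ : 0 ≤ δ) (hab : a + δ ≤ b) :
    f a + f b ≤ f (a + δ) + f (b - δ) := by
  rcases (show a ≤ b by linarith).eq_or_lt with rfl | hlt
  · have : δ = 0 := by linarith
    simp [this]
  have hne : b - a ≠ 0 := by linarith
  have hpos : 0 ≤ b - a := by linarith
  have hu : 0 ≤ δ / (b - a) := div_nonneg hδ hpos
  have hv : 0 ≤ 1 - δ / (b - a) := by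
    rw [sub_nonneg, div_le_one (by linarith)]; linarith
  have h1 := hf.2 ha hb hv hu (by ring)
  have h2 := hf.2 ha hb hu hv (by ring)
  have e1 : (1 - δ / (b - a)) • a + (δ / (b - a)) • b = a + δ := by
    simp only [smul_eq_mul]; field_simp; ring
  have e2 : (δ / (b - a)) • a + (1 - δ / (b - a)) • b = b - δ := by
    simp only [smul_eq_mul]; field_simp; ring
  rw [e1] at h1
  rw [e2] at h2
  simp only [smul_eq_mul] at h1 h2
  nlinarith

theorem sum_update_two {f : Fin n → ℝ → ℝ} {i j : Fin n} (hij : i ≠ j) (x : Fin n → ℝ) (a b : ℝ) :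
    ∑ m, f m (Function.update (Function.update x i a) j b m)
      = ∑ m, f m (x m) + (f i a - f i (x i)) + (f j b - f j (x j)) := by
  have h : ∀ m, f m (Function.update (Function.update x i a) j b m) =
      f m (x m) + (if m = i then f i a - f i (x i) else 0)
        + (if m = j then f j b - f j (x j) else 0) := by
    intro m
    by_cases hmj : m = j
    · subst hmj
      simp [hij.symm]
    · by_cases hmi : m = i
      · subst hmi
        simp [hmj]
      · simp [hmi, hmj]
  simp [h, Finset.sum_add_distrib]

/-- Splits of least norm among the optimal ones increase with the total. -/
theorem minimalSplits_mono (hk : ∀ i, ConcaveOn ℝ (Icc 0 1) (k i)) {p q : ℝ} (hpq : p ≤ q)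
    {x y : Fin n → ℝ} (hx : x ∈ minimalSplits k p) (hy : y ∈ minimalSplits k q) (i : Fin n) :
    x i ≤ y i := by
  by_contra! hi
  obtain ⟨j, hj⟩ : ∃ j, x j < y j := by
    by_contra! hle
    have : ∑ m, y m < ∑ m, x m := Finset.sum_lt_sum (fun m _ => hle m) ⟨i, Finset.mem_univ i, hi⟩
    rw [hx.1.1.2, hy.1.1.2] at this
    linarith
  have hij : i ≠ j := by
    rintro rfl
    exact absurd hi hj.not_gt
  -- Exchange: move `δ` from `i` to `j` in `x` and back in `y`. By concavity the two objective
  -- values do not drop in total, so both new splits are still optimal. Since `2 * δ` is at most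
  -- both gaps, the total squared norm strictly decreases, contradicting minimality.
  obtain ⟨δ, hδ0, hδi, hδj⟩ : ∃ δ > 0, 2 * δ ≤ x i - y i ∧ 2 * δ ≤ y j - x j :=
    ⟨min (x i - y i) (y j - x j) / 2, half_pos (lt_min (by linarith) (by linarith)),
      by linarith [min_le_left (x i - y i) (y j - x j)],
      by linarith [min_le_right (x i - y i) (y j - x j)]⟩
  set u := Function.update (Function.update x i (x i - δ)) j (x j + δ) with hu
  set v := Function.update (Function.update y i (y i + δ)) j (y j - δ) with hv
  have hxI := hx.1.1.1
  have hyI := hy.1.1.1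
  have huS : u ∈ splits n p := by
    constructor
    · intro m
      by_cases hmj : m = j
      · subst hmj
        simp only [hu, Function.update_self]
        exact ⟨by linarith [(hxI m).1], by linarith [(hyI m).2]⟩
      · by_cases hmi : m = i
        · subst hmi
          simp only [hu, Function.update_of_ne hmj, Function.update_self]
          exact ⟨by linarith [(hyI m).1], by linarith [(hxI m).2]⟩
        · simp only [hu, Function.update_of_ne hmj, Function.update_of_ne hmi]
          exact hxI m
    · have := sum_update_two (f := fun _ t => t) hij x (x i - δ) (x j + δ)
      rw [← hu, hx.1.1.2] at this
      linarith
  have hvS : v ∈ splits n q := by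
    constructor
    · intro m
      by_cases hmj : m = j
      · subst hmj
        simp only [hv, Function.update_self]
        exact ⟨by linarith [(hxI m).1], by linarith [(hyI m).2]⟩
      · by_cases hmi : m = i
        · subst hmi
          simp only [hv, Function.update_of_ne hmj, Function.update_self]
          exact ⟨by linarith [(hyI m).1], by linarith [(hxI m).2]⟩
        · simp only [hv, Function.update_of_ne hmj, Function.update_of_ne hmi]
          exact hyI m
    · have := sum_update_two (f := fun _ t => t) hij y (y i + δ) (y j - δ)
      rw [← hv, hy.1.1.2] at this
      linarith
  have hFu := sum_update_two (f := k) hij x (x i - δ) (x j + δ)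
  have hFv := sum_update_two (f := k) hij y (y i + δ) (y j - δ)
  rw [← hu] at hFu
  rw [← hv] at hFv
  have hci := add_le_add_of_concaveOn (hk i) (hyI i) (hxI i) hδ0.le (by linarith)
  have hcj := add_le_add_of_concaveOn (hk j) (hxI j) (hyI j) hδ0.le (by linarith)
  have hux := hx.1.2 u huS
  have hvy := hy.1.2 v hvS
  have huO : u ∈ optimalSplits k p := ⟨huS, fun z hz => (hx.1.2 z hz).trans (by linarith)⟩
  have hvO : v ∈ optimalSplits k q := ⟨hvS, fun z hz => (hy.1.2 z hz).trans (by linarith)⟩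
  have hQu := sum_update_two (f := fun _ t => t ^ 2) hij x (x i - δ) (x j + δ)
  have hQv := sum_update_two (f := fun _ t => t ^ 2) hij y (y i + δ) (y j - δ)
  rw [← hu] at hQu
  rw [← hv] at hQv
  have h1 := hx.2 u huO
  have h2 := hy.2 v hvO
  nlinarith [mul_pos hδ0 hδ0, mul_nonneg hδ0.le (sub_nonneg.2 hδi),
    mul_nonneg hδ0.le (sub_nonneg.2 hδj)]

/-- A sup-convolution of concave functions has an increasing family of optimal splits. -/
theorem exists_monotone_optimalSplits (hn : 1 ≤ n) (hk : ∀ i, ConcaveOn ℝ (Icc 0 1) (k i))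
    (hkc : ∀ i, ContinuousOn (k i) (Icc 0 1)) :
    ∃ x : ℝ → Fin n → ℝ, MonotoneOn x (Icc 0 n) ∧ ∀ p ∈ Icc (0 : ℝ) n, x p ∈ optimalSplits k p := by
  have : ∀ p : ℝ, ∃ y : Fin n → ℝ, p ∈ Icc (0 : ℝ) n → y ∈ minimalSplits k p := fun p => by
    by_cases hp : p ∈ Icc (0 : ℝ) n
    · obtain ⟨y, hy⟩ := minimalSplits_nonempty hn hkc hp
      exact ⟨y, fun _ => hy⟩
    · exact ⟨0, fun h => absurd h hp⟩
  choose x hx using this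
  exact ⟨x, fun p hp q hq hpq i => minimalSplits_mono hk hpq (hx p hp) (hx q hq) i,
    fun p hp => (hx p hp).1⟩

theorem monotoneOn_supConv (hn : 1 ≤ n) (hk : ∀ i, ConcaveOn ℝ (Icc 0 1) (k i))
    (hkc : ∀ i, ContinuousOn (k i) (Icc 0 1)) (hkm : ∀ i, MonotoneOn (k i) (Icc 0 1)) :
    MonotoneOn (supConv k) (Icc 0 n) := by
  obtain ⟨x, hxm, hx⟩ := exists_monotone_optimalSplits hn hk hkc
  intro p hp q hq hpq
  rw [supConv_eq_of_mem (hx p hp), supConv_eq_of_mem (hx q hq)]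
  exact Finset.sum_le_sum fun i _ =>
    hkm i ((hx p hp).1.1 i) ((hx q hq).1.1 i) (hxm hp hq hpq i)

/-- The domain is `[0, n]` rather than `[0, 1]` because supergradient inequalities will be evaluated
at sums of `n` tail probabilities. -/
theorem concaveOn_supConv (hn : 1 ≤ n) (hk : ∀ i, ConcaveOn ℝ (Icc 0 1) (k i))
    (hkc : ∀ i, ContinuousOn (k i) (Icc 0 1)) :
    ConcaveOn ℝ (Icc (0 : ℝ) n) (supConv k) := by
  refine ⟨convex_Icc _ _, fun p hp q hq a b ha hb hab => ?_⟩
  obtain ⟨x, hx⟩ := optimalSplits_nonempty hn hkc hp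
  obtain ⟨y, hy⟩ := optimalSplits_nonempty hn hkc hq
  rw [supConv_eq_of_mem hx, supConv_eq_of_mem hy]
  have hz : ∀ i, a • x i + b • y i ∈ Icc (0 : ℝ) 1 := fun i =>
    convex_Icc 0 1 (hx.1.1 i) (hy.1.1 i) ha hb hab
  have hsum : ∑ i, (a • x i + b • y i) = a • p + b • q := by
    rw [Finset.sum_add_distrib, ← Finset.smul_sum, ← Finset.smul_sum, hx.1.2, hy.1.2]
  rw [← hsum, Finset.smul_sum, Finset.smul_sum, ← Finset.sum_add_distrib]
  exact (Finset.sum_le_sum fun i _ => (hk i).2 (hx.1.1 i) (hy.1.1 i) ha hb hab).trans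
    (sum_le_supConv hn hkc hz)

theorem supConv_zero (hk0 : ∀ i, k i 0 = 0) : supConv k 0 = 0 := by
  have hy : (0 : Fin n → ℝ) ∈ optimalSplits k 0 := by
    refine ⟨⟨fun _ => ⟨le_rfl, zero_le_one⟩, by simp⟩, fun z hz => ?_⟩
    have : ∀ i, z i = 0 := fun i =>
      (Finset.sum_eq_zero_iff_of_nonneg fun i _ => (hz.1 i).1).1 hz.2 i (Finset.mem_univ i)
    simp [this]
  rw [supConv_eq_of_mem hy]
  simp [hk0]

theorem supConv_le_sum (hn : 1 ≤ n) (hkc : ∀ i, ContinuousOn (k i) (Icc 0 1))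
    (hkm : ∀ i, MonotoneOn (k i) (Icc 0 1)) {x : ℝ} (hx : x ∈ Icc (0 : ℝ) 1) :
    supConv k x ≤ ∑ i, k i x := by
  have hn' : (1 : ℝ) ≤ n := by exact_mod_cast hn
  obtain ⟨y, hy⟩ := optimalSplits_nonempty hn hkc ⟨hx.1, hx.2.trans hn'⟩
  rw [supConv_eq_of_mem hy]
  refine Finset.sum_le_sum fun i _ => hkm i (hy.1.1 i) hx ?_
  rw [← hy.1.2]
  exact Finset.single_le_sum (fun j _ => (hy.1.1 j).1) (Finset.mem_univ i)

/-- Give the whole unit to one index. This makes the normalizing constant positive. -/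
theorem one_le_supConv_one (hn : 1 ≤ n) (hkc : ∀ i, ContinuousOn (k i) (Icc 0 1))
    (hk0 : ∀ i, k i 0 = 0) (hk1 : ∀ i, k i 1 = 1) : 1 ≤ supConv k 1 := by
  have h := sum_le_supConv hn hkc (z := Pi.single ⟨0, hn⟩ 1) (fun i => by
    by_cases hi : i = ⟨0, hn⟩
    · subst hi; simp
    · simp [hi])
  have h1 : ∑ i, k i ((Pi.single ⟨0, hn⟩ 1 : Fin n → ℝ) i) = 1 := by
    rw [Finset.sum_eq_single ⟨0, hn⟩]
    · simp [hk1]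
    · intro i _ hi; simp [hi, hk0]
    · simp
  rw [h1] at h
  simpa using h

/-- The slopes of chords of a concave function that end at `q`, in the infimum, give a decreasing
selection of supergradients. -/
theorem exists_antitone_supergradient {K : ℝ → ℝ} {b : ℝ} (hK : ConcaveOn ℝ (Icc 0 b) K)
    (hKm : MonotoneOn K (Icc 0 b)) (hK0 : K 0 = 0) :
    ∃ D : ℝ → ℝ, AntitoneOn D (Ioc 0 b) ∧ ∀ q ∈ Ioc 0 b, 0 ≤ D q ∧ D q ≤ K q / q ∧
      ∀ s ∈ Icc 0 b, K s ≤ K q + D q * (s - q) := by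
  set D : ℝ → ℝ := fun q => sInf ((fun s => (K q - K s) / (q - s)) '' Ico 0 q) with hD
  have hne : ∀ q ∈ Ioc 0 b, ((fun s => (K q - K s) / (q - s)) '' Ico 0 q).Nonempty := fun q hq =>
    (nonempty_Ico.2 hq.1).image _
  have hnn : ∀ q ∈ Ioc 0 b, ∀ r ∈ (fun s => (K q - K s) / (q - s)) '' Ico 0 q, 0 ≤ r := by
    rintro q hq _ ⟨s, hs, rfl⟩
    exact div_nonneg (sub_nonneg.2 (hKm ⟨hs.1, hs.2.le.trans hq.2⟩ ⟨hq.1.le, hq.2⟩ hs.2.le))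
      (sub_nonneg.2 hs.2.le)
  have hle : ∀ q ∈ Ioc 0 b, ∀ s ∈ Ico 0 q, D q ≤ (K q - K s) / (q - s) := fun q hq s hs =>
    csInf_le ⟨0, hnn q hq⟩ ⟨s, hs, rfl⟩
  have hge : ∀ q ∈ Ioc 0 b, ∀ s, q < s → s ≤ b → (K s - K q) / (s - q) ≤ D q := by
    intro q hq s hqs hsb
    apply le_csInf (hne q hq)
    rintro _ ⟨r, hr, rfl⟩
    exact hK.slope_anti_adjacent ⟨hr.1, (hr.2.trans hqs).le.trans hsb⟩
      ⟨hq.1.le.trans hqs.le, hsb⟩ hr.2 hqs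
  refine ⟨D, ?_, fun q hq => ⟨le_csInf (hne q hq) (hnn q hq), ?_, ?_⟩⟩
  · intro q hq r hr hqr
    rcases hqr.eq_or_lt with rfl | hlt
    · exact le_rfl
    · exact (hle r hr q ⟨hq.1.le, hlt⟩).trans (hge q hq r hlt hr.2)
  · simpa [hK0] using hle q hq 0 ⟨le_rfl, hq.1⟩
  · intro s hs
    rcases lt_trichotomy s q with h | rfl | h
    · have := hle q hq s ⟨hs.1, h⟩
      rw [le_div_iff₀ (by linarith)] at this
      linarith
    · simp
    · have := hge q hq s h hs.2
      rw [div_le_iff₀ (by linarith)] at this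
      linarith

end SupConvolution

/-! ### Upper bound by the sup-convolution for concave distortions. -/

section ConcaveBound

/-- The primitive of an increasing function is convex and vanishes at `0`, hence is superadditive on
the half-line. -/
theorem sum_integral_le_of_monotone {w : ℝ → ℝ} (hw : Monotone w) {ι : Type*} (s : Finset ι)
    {a : ι → ℝ} (ha : ∀ i, 0 ≤ a i) :
    ∑ i ∈ s, ∫ y in (0 : ℝ)..a i, w y ≤ ∫ y in (0 : ℝ)..∑ i ∈ s, a i, w y := by
  classical
  have hint : ∀ u v : ℝ, IntervalIntegrable w volume u v := fun u v => hw.intervalIntegrable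
  induction s using Finset.induction_on with
  | empty => simp
  | insert b s hb ih =>
    rw [Finset.sum_insert hb, Finset.sum_insert hb,
      ← intervalIntegral.integral_add_adjacent_intervals (hint 0 (∑ i ∈ s, a i))
        (hint _ (a b + ∑ i ∈ s, a i))]
    set c := ∑ i ∈ s, a i
    have hc : 0 ≤ c := Finset.sum_nonneg fun i _ => ha i
    have hshift : ∫ y in c..a b + c, w y = ∫ y in (0 : ℝ)..a b, w (y + c) := by
      rw [intervalIntegral.integral_comp_add_right]
      simp
    have hle : ∫ y in (0 : ℝ)..a b, w y ≤ ∫ y in (0 : ℝ)..a b, w (y + c) :=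
      intervalIntegral.integral_mono_on (ha b) (hint _ _)
        (Monotone.intervalIntegrable fun x y hxy => hw (by linarith))
        fun y _ => hw (by linarith)
    linarith

theorem integrableOn_Ioc_of_bounded {f : ℝ → ℝ} (hf : Measurable f) {C : ℝ} (hC : ∀ y, |f y| ≤ C)
    (a b : ℝ) : IntegrableOn f (Ioc a b) :=
  Measure.integrableOn_of_bounded (M := C) (by simp) hf.aestronglyMeasurable
    (Filter.Eventually.of_forall fun y => hC y)

variable {Ω : Type*} [MeasurableSpace Ω] {P : Measure Ω} [IsProbabilityMeasure P]

/-- A weighted layer cake formula. -/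
theorem integral_mul_measureReal_ge {w : ℝ → ℝ} (hw : Measurable w) {B : ℝ}
    (hwB : ∀ y, |w y| ≤ B) {Y : Ω → ℝ} (hY : Measurable Y) {L : ℝ} (hY0 : ∀ ω, 0 ≤ Y ω)
    (hYL : ∀ ω, Y ω ≤ L) :
    ∫ y in Ioc 0 L, w y * P.real {ω | y ≤ Y ω} = ∫ ω, (∫ y in (0 : ℝ)..Y ω, w y) ∂P := by
  have hB : 0 ≤ B := (abs_nonneg _).trans (hwB 0)
  have hset : MeasurableSet {z : Ω × ℝ | z.2 ≤ Y z.1} :=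
    measurableSet_le measurable_snd (hY.comp measurable_fst)
  set F : Ω × ℝ → ℝ := {z : Ω × ℝ | z.2 ≤ Y z.1}.indicator fun z => w z.2 with hF
  have hFm : Measurable F := (hw.comp measurable_snd).indicator hset
  have hFi : Integrable F (P.prod (volume.restrict (Ioc 0 L))) := by
    refine Integrable.of_bound hFm.aestronglyMeasurable B (Filter.Eventually.of_forall fun z => ?_)
    by_cases hz : z ∈ {z : Ω × ℝ | z.2 ≤ Y z.1}
    · rw [hF, indicator_of_mem hz]; exact hwB _
    · rw [hF, indicator_of_notMem hz]; simpa using hB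
  have hswap := integral_integral_swap (f := fun ω y => F (ω, y)) hFi
  have h1 : ∀ y, ∫ ω, F (ω, y) ∂P = w y * P.real {ω | y ≤ Y ω} := by
    intro y
    have : (fun ω => F (ω, y)) = {ω | y ≤ Y ω}.indicator fun _ => w y := by
      ext ω; simp [hF, indicator]
    rw [this, integral_indicator_const _ (measurableSet_le measurable_const hY), smul_eq_mul,
      mul_comm]
  have h2 : ∀ ω, ∫ y in Ioc 0 L, F (ω, y) = ∫ y in (0 : ℝ)..Y ω, w y := by
    intro ω
    have : (fun y => F (ω, y)) = (Iic (Y ω)).indicator w := by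
      ext y; simp [hF, indicator]
    rw [this, setIntegral_indicator measurableSet_Iic, intervalIntegral.integral_of_le (hY0 ω),
      Ioc_inter_Iic, min_eq_right (hYL ω)]
  simp only [h1, h2] at hswap
  exact hswap.symm

/-- By the layer cake formula both sides are expectations of the superadditive primitive of `w`, and
the inequality holds pointwise in `ω`. -/
theorem sum_integral_mul_measureReal_ge_le {n : ℕ} {w : ℝ → ℝ} (hw : Monotone w) {B : ℝ}
    (hwB : ∀ y, |w y| ≤ B) {Y : Fin n → Ω → ℝ} (hY : ∀ i, Measurable (Y i)) {L : ℝ}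
    (hY0 : ∀ i ω, 0 ≤ Y i ω) (hYL : ∀ i ω, Y i ω ≤ L) (hZL : ∀ ω, ∑ i, Y i ω ≤ L) :
    ∑ i, ∫ y in Ioc 0 L, w y * P.real {ω | y ≤ Y i ω}
      ≤ ∫ y in Ioc 0 L, w y * P.real {ω | y ≤ ∑ i, Y i ω} := by
  have hint : ∀ u v : ℝ, IntervalIntegrable w volume u v := fun u v => hw.intervalIntegrable
  have hG : Continuous fun x => ∫ y in (0 : ℝ)..x, w y :=
    intervalIntegral.continuous_primitive hint 0
  have hGi : ∀ V : Ω → ℝ, Measurable V → (∀ ω, 0 ≤ V ω) → (∀ ω, V ω ≤ L) →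
      Integrable (fun ω => ∫ y in (0 : ℝ)..V ω, w y) P := by
    intro V hV hV0 hVL
    refine Integrable.of_bound (hG.measurable.comp hV).aestronglyMeasurable (B * L)
      (Filter.Eventually.of_forall fun ω => ?_)
    refine (intervalIntegral.norm_integral_le_of_norm_le_const (C := B)
      fun y _ => hwB y).trans ?_
    rw [sub_zero, abs_of_nonneg (hV0 ω)]
    exact mul_le_mul_of_nonneg_left (hVL ω) ((abs_nonneg _).trans (hwB 0))
  have hZ0 : ∀ ω, 0 ≤ ∑ i, Y i ω := fun ω => Finset.sum_nonneg fun i _ => hY0 i ω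
  have hZm : Measurable fun ω => ∑ i, Y i ω := Finset.measurable_fun_sum _ fun i _ => hY i
  rw [integral_mul_measureReal_ge hw.measurable hwB hZm hZ0 hZL,
    Finset.sum_congr rfl fun i _ =>
      integral_mul_measureReal_ge hw.measurable hwB (hY i) (hY0 i) (hYL i),
    ← integral_finsetSum _ fun i _ => hGi _ (hY i) (hY0 i) (hYL i)]
  exact integral_mono (integrable_finsetSum _ fun i _ => hGi _ (hY i) (hY0 i) (hYL i))
    (hGi _ hZm hZ0 hZL) fun ω => sum_integral_le_of_monotone hw _ fun i => hY0 i ω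

/-- At level `y` the sum of the `k i` is at most `supConv k` of the summed tails, hence at most a
supporting line with slope `w y`. Tails decrease in `y`, so `w` increases, and the weighted
comparison replaces the summed tails by the tail of the total. -/
theorem sum_choquet_le_supConv_add {n : ℕ} (hn : 1 ≤ n) {k : Fin n → ℝ → ℝ}
    (hk : ∀ i, ConcaveOn ℝ (Icc 0 1) (k i)) (hkc : ∀ i, ContinuousOn (k i) (Icc 0 1))
    (hkm : ∀ i, MonotoneOn (k i) (Icc 0 1)) (hk0 : ∀ i, k i 0 = 0) {Y : Fin n → Ω → ℝ} {L : ℝ}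
    (hY : ∀ i, Measurable (Y i)) (hL : 0 ≤ L) (hY0 : ∀ i ω, 0 ≤ Y i ω)
    (hYL : ∀ i ω, Y i ω ≤ L) (hZL : ∀ ω, ∑ i, Y i ω ≤ L) {δ : ℝ} (hδ : δ ∈ Ioc (0 : ℝ) 1) :
    ∑ i, choquet P (k i) (Y i)
      ≤ choquet P (supConv k) (fun ω => ∑ i, Y i ω) + L * supConv k δ := by
  have hn' : (1 : ℝ) ≤ n := by exact_mod_cast hn
  set K := supConv k with hKdef
  have hK : ConcaveOn ℝ (Icc (0 : ℝ) n) K := concaveOn_supConv hn hk hkc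
  have hKm : MonotoneOn K (Icc (0 : ℝ) n) := monotoneOn_supConv hn hk hkc hkm
  have hK0 : K 0 = 0 := supConv_zero hk0
  obtain ⟨D, hDa, hD⟩ := exists_antitone_supergradient hK hKm hK0
  have hKm1 : MonotoneOn K (Icc 0 1) := hKm.mono (Icc_subset_Icc_right hn')
  set p : ℝ → ℝ := fun y => P.real {ω | y ≤ ∑ i, Y i ω} with hp
  have hpI : ∀ y, p y ∈ Icc (0 : ℝ) 1 := fun y => measureReal_ge_mem P _ y
  have hpa : Antitone p := antitone_measureReal_ge P _
  -- The slope of `K` may blow up at `0`. Truncating the base point at `δ` keeps the weights below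
  -- `K 1 / δ`, at a cost of at most `K δ` per level.
  set q : ℝ → ℝ := fun y => max (p y) δ with hq
  have hqa : Antitone q := fun a b hab => max_le_max_right _ (hpa hab)
  have hqI : ∀ y, q y ∈ Ioc (0 : ℝ) 1 := fun y =>
    ⟨hδ.1.trans_le (le_max_right _ _), max_le (hpI y).2 hδ.2⟩
  have hqI' : ∀ y, q y ∈ Ioc (0 : ℝ) n := fun y => ⟨(hqI y).1, (hqI y).2.trans hn'⟩
  set w : ℝ → ℝ := fun y => D (q y) with hw
  have hwm : Monotone w := fun a b hab => hDa (hqI' b) (hqI' a) (hqa hab)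
  have hKq : ∀ y, 0 ≤ K (q y) ∧ K (q y) ≤ K 1 := fun y => by
    constructor
    · rw [← hK0]; exact hKm1 ⟨le_rfl, zero_le_one⟩ ⟨(hqI y).1.le, (hqI y).2⟩ (hqI y).1.le
    · exact hKm1 ⟨(hqI y).1.le, (hqI y).2⟩ ⟨zero_le_one, le_rfl⟩ (hqI y).2
  have hw0 : ∀ y, 0 ≤ w y := fun y => (hD _ (hqI' y)).1
  have hK1 : 0 ≤ K 1 := (hKq 0).1.trans (hKq 0).2
  have hwB : ∀ y, |w y| ≤ K 1 / δ := fun y => by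
    rw [abs_of_nonneg (hw0 y)]
    exact (hD _ (hqI' y)).2.1.trans
      (div_le_div₀ hK1 (hKq y).2 hδ.1 (le_max_right _ _))
  have hKqi : IntegrableOn (fun y => K (q y)) (Ioc 0 L) :=
    integrableOn_Ioc_of_bounded (C := K 1)
      (Antitone.measurable fun a b hab => hKm (Ioc_subset_Icc_self (hqI' b))
        (Ioc_subset_Icc_self (hqI' a)) (hqa hab))
      (fun y => by rw [abs_of_nonneg (hKq y).1]; exact (hKq y).2) _ _
  have hwi : ∀ f : ℝ → ℝ, Measurable f → (∀ y, f y ∈ Icc (0 : ℝ) 1) →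
      IntegrableOn (fun y => w y * f y) (Ioc 0 L) := fun f hf hfI =>
    integrableOn_Ioc_of_bounded (C := K 1 / δ * 1) (hwm.measurable.fun_mul hf) (fun y => by
      rw [abs_mul, abs_of_nonneg (hfI y).1]
      exact mul_le_mul (hwB y) (hfI y).2 (hfI y).1 (div_nonneg hK1 hδ.1.le)) _ _
  have hwq := hwi q hqa.measurable fun y => Ioc_subset_Icc_self (hqI y)
  have hwp := hwi p hpa.measurable hpI
  have hwpi := fun i => hwi _ (antitone_measureReal_ge P (Y i)).measurable
    (measureReal_ge_mem P (Y i))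
  have hki : ∀ i, IntegrableOn (fun y => k i (P.real {ω | y ≤ Y i ω})) (Ioc 0 L) := fun i =>
    integrableOn_comp_measureReal_ge (hkm i) _ _ _
  have hKp : IntegrableOn (fun y => K (p y)) (Ioc 0 L) :=
    integrableOn_comp_measureReal_ge hKm1 _ _ _
  have hKwq : IntegrableOn (fun y => K (q y) - w y * q y) (Ioc 0 L) := hKqi.sub hwq
  calc ∑ i, choquet P (k i) (Y i)
      = ∑ i, ∫ y in Ioc 0 L, k i (P.real {ω | y ≤ Y i ω}) :=
        Finset.sum_congr rfl fun i _ => choquet_eq_setIntegral (hk0 i) (hYL i)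
    _ = ∫ y in Ioc 0 L, ∑ i, k i (P.real {ω | y ≤ Y i ω}) :=
        (integral_finsetSum _ fun i _ => hki i).symm
    _ ≤ ∫ y in Ioc 0 L, ((K (q y) - w y * q y) + ∑ i, w y * P.real {ω | y ≤ Y i ω}) := by
        refine integral_mono (integrable_finsetSum _ fun i _ => hki i)
          (hKwq.add (integrable_finsetSum _ fun i _ => hwpi i)) fun y => ?_
        have hz : ∀ i, P.real {ω | y ≤ Y i ω} ∈ Icc (0 : ℝ) 1 := fun i =>
          measureReal_ge_mem P _ y
        have hs : ∑ i, P.real {ω | y ≤ Y i ω} ∈ Icc (0 : ℝ) n := by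
          refine ⟨Finset.sum_nonneg fun i _ => (hz i).1, ?_⟩
          calc _ ≤ ∑ _i : Fin n, (1 : ℝ) := Finset.sum_le_sum fun i _ => (hz i).2
            _ = n := by simp
        have h1 := sum_le_supConv hn hkc hz
        have h2 := (hD _ (hqI' y)).2.2 _ hs
        simp only [← Finset.mul_sum]
        linarith
    _ = (∫ y in Ioc 0 L, (K (q y) - w y * q y))
          + ∑ i, ∫ y in Ioc 0 L, w y * P.real {ω | y ≤ Y i ω} := by
        rw [integral_add hKwq (integrable_finsetSum _ fun i _ => hwpi i),
          integral_finsetSum _ fun i _ => hwpi i]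
    _ ≤ (∫ y in Ioc 0 L, (K (q y) - w y * q y)) + ∫ y in Ioc 0 L, w y * p y := by
        gcongr
        exact sum_integral_mul_measureReal_ge_le hwm hwB hY hY0 hYL hZL
    _ = ∫ y in Ioc 0 L, (K (q y) - w y * q y + w y * p y) :=
        (integral_add hKwq hwp).symm
    _ ≤ ∫ y in Ioc 0 L, (K (p y) + K δ) := by
        refine integral_mono (hKwq.add hwp)
          (hKp.add (integrableOn_const (by simp))) fun y => ?_
        have h1 : w y * p y ≤ w y * q y :=
          mul_le_mul_of_nonneg_left (le_max_left _ _) (hw0 y)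
        have h2 : K (q y) ≤ K (p y) + K δ := by
          have e1 : 0 ≤ K (p y) := by
            rw [← hK0]; exact hKm1 ⟨le_rfl, zero_le_one⟩ (hpI y) (hpI y).1
          have e2 : 0 ≤ K δ := by
            rw [← hK0]; exact hKm1 ⟨le_rfl, zero_le_one⟩ ⟨hδ.1.le, hδ.2⟩ hδ.1.le
          rcases max_choice (p y) δ with h | h <;> simp only [hq, h] <;> linarith
        simp only
        linarith
    _ = choquet P K (fun ω => ∑ i, Y i ω) + L * K δ := by
        rw [integral_add hKp (integrableOn_const (by simp)), choquet_eq_setIntegral hK0 hZL]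
        simp [hL, hp]

/-- The aggregate Choquet integral with respect to concave distortions is at most the Choquet
integral of the total with respect to their sup-convolution. -/
theorem sum_choquet_le_supConv {n : ℕ} (hn : 1 ≤ n) {k : Fin n → ℝ → ℝ}
    (hk : ∀ i, ConcaveOn ℝ (Icc 0 1) (k i)) (hkc : ∀ i, ContinuousOn (k i) (Icc 0 1))
    (hkm : ∀ i, MonotoneOn (k i) (Icc 0 1)) (hk0 : ∀ i, k i 0 = 0) {Y : Fin n → Ω → ℝ} {M : ℝ}
    (hY : ∀ i, Measurable (Y i)) (hY0 : ∀ i ω, 0 ≤ Y i ω) (hYM : ∀ i ω, Y i ω ≤ M) :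
    ∑ i, choquet P (k i) (Y i) ≤ choquet P (supConv k) (fun ω => ∑ i, Y i ω) := by
  have hn' : (1 : ℝ) ≤ n := by exact_mod_cast hn
  have hM : 0 ≤ M := by
    obtain ⟨ω⟩ : Nonempty Ω := P.nonempty_of_neZero
    exact (hY0 ⟨0, hn⟩ ω).trans (hYM _ ω)
  have hZL : ∀ ω, ∑ i, Y i ω ≤ n * M := fun ω => by
    calc ∑ i, Y i ω ≤ ∑ _i : Fin n, M := Finset.sum_le_sum fun i _ => hYM i ω
      _ = n * M := by simp
  have hYL : ∀ i ω, Y i ω ≤ n * M := fun i ω => (hYM i ω).trans (by nlinarith)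
  -- The error is controlled by `∑ i, k i δ`, which vanishes as `δ` decreases to `0` by continuity.
  have hev : ∀ᶠ δ in nhdsWithin (0 : ℝ) (Ioc 0 1), ∑ i, choquet P (k i) (Y i)
      ≤ choquet P (supConv k) (fun ω => ∑ i, Y i ω) + n * M * ∑ i, k i δ := by
    filter_upwards [self_mem_nhdsWithin] with δ hδ
    refine (sum_choquet_le_supConv_add hn hk hkc hkm hk0 hY (by positivity) hY0 hYL hZL hδ).trans ?_
    gcongr
    exact supConv_le_sum hn hkc hkm (Ioc_subset_Icc_self hδ)
  have hlim : Filter.Tendsto (fun δ => choquet P (supConv k) (fun ω => ∑ i, Y i ω)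
      + n * M * ∑ i, k i δ) (nhdsWithin (0 : ℝ) (Ioc 0 1))
      (nhds (choquet P (supConv k) (fun ω => ∑ i, Y i ω))) := by
    have h1 : ContinuousWithinAt (fun δ => choquet P (supConv k) (fun ω => ∑ i, Y i ω)
        + n * M * ∑ i, k i δ) (Icc 0 1) 0 :=
      (((continuousOn_finsetSum _ fun i _ => hkc i).const_mul _).const_add _) 0
        ⟨le_rfl, zero_le_one⟩
    have h2 := (h1.mono Ioc_subset_Icc_self).tendsto
    simpa [hk0] using h2
  have : (nhdsWithin (0 : ℝ) (Ioc 0 1)).NeBot := by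
    rw [nhdsWithin_Ioc_eq_nhdsGT zero_lt_one]; infer_instance
  exact ge_of_tendsto hlim hev

end ConcaveBound

/-! ### Attainment for the maximum of distortions by layered contracts. -/

section ComonotonicAllocation

/-- The length of the part of `E` between `0` and `z`. -/
def partialLength (E : Set ℝ) (z : ℝ) : ℝ := ∫ y in (0 : ℝ)..z, E.indicator (fun _ => 1) y

section PartialLength

variable {E : Set ℝ}

theorem intervalIntegrable_indicator_one (hE : MeasurableSet E) (a b : ℝ) :
    IntervalIntegrable (E.indicator fun _ => (1 : ℝ)) volume a b :=
  ⟨(integrableOn_const (by simp)).indicator hE, (integrableOn_const (by simp)).indicator hE⟩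

theorem continuous_partialLength (hE : MeasurableSet E) : Continuous (partialLength E) :=
  intervalIntegral.continuous_primitive (intervalIntegrable_indicator_one hE) 0

theorem monotone_partialLength (hE : MeasurableSet E) : Monotone (partialLength E) := by
  intro a b hab
  have h := intervalIntegral.integral_add_adjacent_intervals
    (intervalIntegrable_indicator_one hE 0 a) (intervalIntegrable_indicator_one hE a b)
  have h2 : 0 ≤ ∫ y in a..b, E.indicator (fun _ => (1 : ℝ)) y :=
    intervalIntegral.integral_nonneg hab fun y _ => indicator_nonneg (fun _ _ => zero_le_one) y
  simp only [partialLength]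
  linarith

theorem partialLength_zero : partialLength E 0 = 0 := intervalIntegral.integral_same

theorem partialLength_nonneg (hE : MeasurableSet E) {z : ℝ} (hz : 0 ≤ z) :
    0 ≤ partialLength E z := by
  rw [← partialLength_zero (E := E)]
  exact monotone_partialLength hE hz

theorem volume_inter_Ioc_eq_partialLength (hE : MeasurableSet E) {z : ℝ} (hz : 0 ≤ z) :
    volume (E ∩ Ioc 0 z) = ENNReal.ofReal (partialLength E z) := by
  have : partialLength E z = volume.real (E ∩ Ioc 0 z) := by
    rw [partialLength, intervalIntegral.integral_of_le hz, integral_indicator hE]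
    simp [Measure.restrict_restrict hE]
  rw [this, ofReal_measureReal ((measure_mono inter_subset_right).trans_lt (by simp)).ne]

theorem sum_partialLength {n : ℕ} {E : Fin n → Set ℝ} (hE : ∀ i, MeasurableSet (E i))
    (hd : Pairwise (Function.onFun Disjoint E)) (hu : ⋃ i, E i = univ) (z : ℝ) :
    ∑ i, partialLength (E i) z = z := by
  simp only [partialLength]
  rw [← intervalIntegral.integral_finsetSum
    fun i _ => intervalIntegrable_indicator_one (hE i) 0 z]
  have : ∀ y : ℝ, ∑ i, (E i).indicator (fun _ => (1 : ℝ)) y = 1 := by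
    intro y
    obtain ⟨j, hj⟩ := mem_iUnion.1 (hu ▸ mem_univ y : y ∈ ⋃ i, E i)
    rw [Finset.sum_eq_single j, indicator_of_mem hj]
    · intro i _ hij
      exact indicator_of_notMem (fun hi => (hd hij).le_bot ⟨hi, hj⟩) _
    · simp
  simp [this]

/-- The function `partialLength E` maps Lebesgue measure on `E` to Lebesgue measure. -/
theorem map_partialLength (hE : MeasurableSet E) {M : ℝ} (hM : 0 ≤ M) :
    (volume.restrict (E ∩ Ioc 0 M)).map (partialLength E)
      = volume.restrict (Ioc 0 (partialLength E M)) := by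
  set f := partialLength E with hf
  have hfc : Continuous f := continuous_partialLength hE
  have hfm : Monotone f := monotone_partialLength hE
  have hf0 : f 0 = 0 := partialLength_zero
  have hfin : IsFiniteMeasure (volume.restrict (E ∩ Ioc 0 M)) :=
    ⟨by simpa using (measure_mono inter_subset_right).trans_lt (by simp)⟩
  refine Measure.ext_of_Iic _ _ fun a => ?_
  rw [Measure.map_apply hfc.measurable measurableSet_Iic,
    Measure.restrict_apply (hfc.measurable measurableSet_Iic),
    Measure.restrict_apply measurableSet_Iic]
  rcases lt_or_ge a 0 with ha | ha
  · have h1 : f ⁻¹' Iic a ∩ (E ∩ Ioc 0 M) = ∅ := by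
      ext y
      simp only [mem_inter_iff, mem_preimage, mem_Iic, mem_Ioc, mem_empty_iff_false, iff_false]
      rintro ⟨h1, -, h2, -⟩
      have := hfm h2.le
      linarith
    have h2 : Iic a ∩ Ioc 0 (f M) = ∅ := by
      ext y
      simp only [mem_inter_iff, mem_Iic, mem_Ioc, mem_empty_iff_false, iff_false]
      rintro ⟨h1, h2, -⟩
      linarith
    rw [h1, h2]
  · obtain ⟨u, ⟨⟨hu0, huM⟩, hua⟩, hu⟩ : ∃ u, IsGreatest (Icc 0 M ∩ f ⁻¹' Iic a) u :=
      (isCompact_Icc.inter_right (isClosed_Iic.preimage hfc)).exists_isGreatest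
        ⟨0, ⟨le_rfl, hM⟩, by simpa [hf0] using ha⟩
    -- `u` is the last point of `[0, M]` where `f ≤ a`; if `f u` were below the minimum, the
    -- intermediate value theorem would give a later one.
    have hfu : f u = min a (f M) := by
      apply le_antisymm (le_min hua (hfm huM))
      obtain ⟨y, hy, hfy⟩ := intermediate_value_Icc huM hfc.continuousOn
        (show min a (f M) ∈ Icc (f u) (f M) from ⟨le_min hua (hfm huM), min_le_right _ _⟩)
      have : y ≤ u := hu ⟨⟨hu0.trans hy.1, hy.2⟩, by
        simp only [mem_preimage, mem_Iic, hfy]; exact min_le_left _ _⟩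
      rw [← hfy]
      exact hfm this
    have h1 : f ⁻¹' Iic a ∩ (E ∩ Ioc 0 M) = E ∩ Ioc 0 u := by
      ext y
      constructor
      · rintro ⟨h1, h2, h3⟩
        exact ⟨h2, h3.1, hu ⟨Ioc_subset_Icc_self h3, h1⟩⟩
      · rintro ⟨h1, h2⟩
        exact ⟨(hfm h2.2).trans hua, h1, h2.1, h2.2.trans huM⟩
    have h2 : Iic a ∩ Ioc 0 (f M) = Ioc 0 (f u) := by
      rw [inter_comm, Ioc_inter_Iic, hfu, min_comm]
    rw [h1, h2, volume_inter_Ioc_eq_partialLength hE hu0, Real.volume_Ioc, sub_zero]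

end PartialLength

variable {Ω : Type*} [MeasurableSpace Ω] {P : Measure Ω} [IsProbabilityMeasure P]

/-- An agent paid exactly the layers in `E` collects at least their contribution: `partialLength E`
carries Lebesgue measure on `E` to Lebesgue measure, and being monotone it maps `{y ≤ Z}` into the
corresponding tail event of the share. -/
theorem setIntegral_le_choquet_partialLength {k : ℝ → ℝ} (hkm : MonotoneOn k (Icc 0 1))
    (hk0 : k 0 = 0) {E : Set ℝ} (hE : MeasurableSet E) {Z : Ω → ℝ} {M : ℝ} (hM : 0 ≤ M)
    (hZM : ∀ ω, Z ω ≤ M) :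
    ∫ y in E ∩ Ioc 0 M, k (P.real {ω | y ≤ Z ω})
      ≤ choquet P k (fun ω => partialLength E (Z ω)) := by
  have hfm := monotone_partialLength hE
  have hanti := antitone_comp_measureReal_ge (P := P) hkm fun ω => partialLength E (Z ω)
  rw [choquet_eq_setIntegral hk0 (M := partialLength E M) (fun ω => hfm (hZM ω)),
    ← map_partialLength hE hM, integral_map (continuous_partialLength hE).measurable.aemeasurable
      hanti.measurable.aestronglyMeasurable]
  refine integral_mono ((integrableOn_comp_measureReal_ge hkm Z 0 M).mono_set inter_subset_right)
    ?_ fun y => ?_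
  · have h2 : Antitone fun y => k (P.real {ω | partialLength E y ≤ partialLength E (Z ω)}) :=
      fun a b hab => hanti (hfm hab)
    exact (((h2.antitoneOn _).integrableOn_isCompact
      (isCompact_Icc (a := 0) (b := M))).mono_set Ioc_subset_Icc_self).mono_set inter_subset_right
  · exact hkm (measureReal_ge_mem P _ _) (measureReal_ge_mem P (fun ω => partialLength E (Z ω)) _)
      (measureReal_mono fun ω hω => hfm hω)

/-- A comonotonic allocation attains the Choquet integral with respect to the largest distortion. -/
theorem exists_allocation_of_max {n : ℕ} {k : Fin n → ℝ → ℝ} {l : ℝ → ℝ}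
    (hkm : ∀ i, MonotoneOn (k i) (Icc 0 1)) (hk0 : ∀ i, k i 0 = 0)
    (hlm : MonotoneOn l (Icc 0 1)) (hl0 : l 0 = 0) (hl : ∀ p ∈ Icc (0 : ℝ) 1, ∃ i, l p ≤ k i p)
    {Z : Ω → ℝ} {M : ℝ} (hZ : Measurable Z) (hZ0 : ∀ ω, 0 ≤ Z ω) (hZM : ∀ ω, Z ω ≤ M) :
    ∃ Y : Fin n → Ω → ℝ, (∀ i, Measurable (Y i)) ∧ (∀ i ω, 0 ≤ Y i ω) ∧
      (∀ ω, ∑ i, Y i ω = Z ω) ∧ choquet P l Z ≤ ∑ i, choquet P (k i) (Y i) := by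
  have hM : 0 ≤ M := by
    obtain ⟨ω⟩ : Nonempty Ω := P.nonempty_of_neZero
    exact (hZ0 ω).trans (hZM ω)
  set p : ℝ → ℝ := fun y => P.real {ω | y ≤ Z ω} with hp
  -- `B i` collects the levels where agent `i` reaches `l`; disjointing breaks ties and assigns
  -- every layer to exactly one agent.
  set B : Fin n → Set ℝ := fun i => {y | l (p y) ≤ k i (p y)} with hB
  have hBm : ∀ i, MeasurableSet (B i) := fun i =>
    measurableSet_le (antitone_comp_measureReal_ge hlm Z).measurable
      (antitone_comp_measureReal_ge (hkm i) Z).measurable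
  have hEm : ∀ i, MeasurableSet (disjointed B i) := fun i => by
    rw [disjointed_apply, Finset.sup_set_eq_biUnion]
    exact (hBm i).diff (Finset.measurableSet_biUnion _ fun j _ => hBm j)
  have hu : ⋃ i, disjointed B i = univ := by
    rw [iUnion_disjointed]
    exact eq_univ_of_forall fun y => mem_iUnion.2 (hl _ (measureReal_ge_mem P Z y))
  have hd : Pairwise (Function.onFun Disjoint (disjointed B)) := disjoint_disjointed B
  have hlint := integrableOn_comp_measureReal_ge (P := P) hlm Z 0 M
  refine ⟨fun i ω => partialLength (disjointed B i) (Z ω),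
    fun i => (continuous_partialLength (hEm i)).measurable.comp hZ,
    fun i ω => partialLength_nonneg (hEm i) (hZ0 ω), fun ω => sum_partialLength hEm hd hu _, ?_⟩
  have hsplit : choquet P l Z = ∑ i, ∫ y in disjointed B i ∩ Ioc 0 M, l (p y) := by
    rw [choquet_eq_setIntegral hl0 hZM, ← integral_iUnion_fintype]
    · rw [← iUnion_inter, hu, univ_inter]
    · exact fun i => (hEm i).inter measurableSet_Ioc
    · exact fun i j hij => (hd hij).mono inter_subset_left inter_subset_left
    · exact fun i => hlint.mono_set inter_subset_right
  rw [hsplit]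
  refine Finset.sum_le_sum fun i _ => ?_
  refine le_trans ?_ (setIntegral_le_choquet_partialLength (hkm i) (hk0 i) (hEm i) hM hZM)
  refine setIntegral_mono_on (hlint.mono_set inter_subset_right)
    ((integrableOn_comp_measureReal_ge (hkm i) Z 0 M).mono_set inter_subset_right)
    ((hEm i).inter measurableSet_Ioc) fun y hy => ?_
  exact disjointed_le B i hy.1

end ComonotonicAllocation

/-! ### Attainment for the sup-convolution by random selection of one agent. -/

section RandomizedAllocation

/-- Each `m i` is dominated by `μ`; its Radon–Nikodym density will serve as the conditional
probability of selecting agent `i`. -/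
theorem exists_densities_of_sum_eq {α : Type*} [MeasurableSpace α] {n : ℕ} {μ : Measure α}
    [IsFiniteMeasure μ] {m : Fin n → Measure α} (hm : ∑ i, m i = μ) :
    ∃ θ : Fin n → α → ℝ, (∀ i, Measurable (θ i)) ∧ (∀ i z, 0 ≤ θ i z) ∧
      (∀ᵐ z ∂μ, ∑ i, θ i z = 1) ∧
      ∀ i s, MeasurableSet s → ∫⁻ z in s, ENNReal.ofReal (θ i z) ∂μ = m i s := by
  have hle : ∀ i, m i ≤ μ := fun i s => by
    rw [← hm, Measure.finsetSum_apply]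
    exact Finset.single_le_sum (f := fun j => m j s) (fun _ _ => zero_le) (Finset.mem_univ i)
  have hac : ∀ i, m i ≪ μ := fun i => Measure.absolutelyContinuous_of_le (hle i)
  have hfin : ∀ i, IsFiniteMeasure (m i) := fun i => isFiniteMeasure_of_le μ (hle i)
  have hd : ∀ i s, MeasurableSet s → ∫⁻ z in s, (m i).rnDeriv μ z ∂μ = m i s := fun i s hs => by
    rw [← withDensity_apply _ hs, Measure.withDensity_rnDeriv_eq _ _ (hac i)]
  have hsum : (fun z => ∑ i, (m i).rnDeriv μ z) =ᵐ[μ] fun _ => 1 := by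
    refine ae_eq_of_forall_setLIntegral_eq_of_sigmaFinite
      (Finset.measurable_fun_sum _ fun i _ => Measure.measurable_rnDeriv _ _) measurable_const
      fun s hs _ => ?_
    rw [lintegral_finsetSum _ fun i _ => Measure.measurable_rnDeriv _ _,
      Finset.sum_congr rfl fun i _ => hd i s hs, ← Measure.finsetSum_apply, hm]
    simp
  have htop : ∀ i, ∀ᵐ z ∂μ, (m i).rnDeriv μ z ≠ ⊤ := fun i =>
    (Measure.rnDeriv_lt_top _ _).mono fun z hz => hz.ne
  refine ⟨fun i z => ((m i).rnDeriv μ z).toReal,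
    fun i => (Measure.measurable_rnDeriv _ _).ennreal_toReal, fun i z => ENNReal.toReal_nonneg,
    ?_, fun i s hs => ?_⟩
  · filter_upwards [hsum, ae_all_iff.2 htop] with z hz hz'
    rw [← ENNReal.toReal_sum fun i _ => hz' i, hz, ENNReal.toReal_one]
  · rw [← hd i s hs]
    refine lintegral_congr_ae (ae_restrict_of_ae ?_)
    filter_upwards [htop i] with z hz
    exact ENNReal.ofReal_toReal hz

theorem map_eq_restrict_Icc_of_isUniform {Ω : Type*} [MeasurableSpace Ω] {P : Measure Ω}
    {U : Ω → ℝ} (hU : pdf.IsUniform U (Icc (0 : ℝ) 1) P volume) :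
    P.map U = volume.restrict (Icc 0 1) := by
  rw [hU, ProbabilityTheory.cond]
  simp

variable {Ω : Type*} [MeasurableSpace Ω] {P : Measure Ω} [IsProbabilityMeasure P]

/-- With the help of an independent uniform random variable, a decomposition of the law of `Z` is
realized by a partition of the probability space. -/
theorem exists_partition_of_sum_eq_map {n : ℕ} {Z U : Ω → ℝ} (hZ : Measurable Z)
    (hUm : Measurable U) (hU : pdf.IsUniform U (Icc (0 : ℝ) 1) P volume) (hUZ : IndepFun U Z P)
    {m : Fin n → Measure ℝ} (hm : ∑ i, m i = P.map Z) :
    ∃ A : Fin n → Set Ω, (∀ i, MeasurableSet (A i)) ∧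
      (∀ᵐ ω ∂P, ∑ i, (A i).indicator (fun _ => (1 : ℝ)) ω = 1) ∧
      ∀ i s, MeasurableSet s → P (Z ⁻¹' s ∩ A i) = m i s := by
  have hprob : IsProbabilityMeasure (P.map Z) := Measure.isProbabilityMeasure_map hZ.aemeasurable
  obtain ⟨θ, hθm, hθ0, hθ1, hθ⟩ := exists_densities_of_sum_eq hm
  -- Partial sums cut `(0, 1]` into consecutive intervals of lengths `θ i z`; given `Z = z`, agent
  -- `i` is selected when `U` lands in the `i`-th.
  set S : ℕ → ℝ → ℝ := fun j z => ∑ i ∈ Finset.univ.filter (fun i : Fin n => (i : ℕ) < j), θ i z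
    with hS
  have hSm : ∀ j, Measurable (S j) := fun j => Finset.measurable_fun_sum _ fun i _ => hθm i
  have hS0 : ∀ z, S 0 z = 0 := fun z => by simp [hS]
  have hSn : ∀ z, S n z = ∑ i, θ i z := fun z => by simp [hS]
  have hSs : ∀ (i : Fin n) z, S (i + 1) z = S i z + θ i z := fun i z => by
    have : Finset.univ.filter (fun l : Fin n => (l : ℕ) < i + 1)
        = insert i (Finset.univ.filter fun l : Fin n => (l : ℕ) < i) := by
      ext l
      simp only [Finset.mem_filter, Finset.mem_univ, true_and, Finset.mem_insert, Fin.ext_iff]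
      omega
    simp only [hS]
    rw [this, Finset.sum_insert (by simp), add_comm]
  have hSnn : ∀ j z, 0 ≤ S j z := fun j z => Finset.sum_nonneg fun i _ => hθ0 i z
  have hSle : ∀ j z, S j z ≤ ∑ i, θ i z := fun j z =>
    Finset.sum_le_sum_of_subset_of_nonneg (Finset.filter_subset _ _) fun i _ _ => hθ0 i z
  set C : Fin n → Set (ℝ × ℝ) := fun i => {a | a.2 ∈ Ioc (S i a.1) (S (i + 1) a.1)} with hC
  have hCm : ∀ i, MeasurableSet (C i) := fun i =>
    (measurableSet_lt ((hSm _).comp measurable_fst) measurable_snd).inter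
      (measurableSet_le measurable_snd ((hSm _).comp measurable_fst))
  have hZU : Measurable fun ω => (Z ω, U ω) := hZ.prodMk hUm
  have hUlaw : P.map U = volume.restrict (Icc 0 1) := map_eq_restrict_Icc_of_isUniform hU
  refine ⟨fun i => (fun ω => (Z ω, U ω)) ⁻¹' C i, fun i => hZU (hCm i), ?_, fun i s hs => ?_⟩
  · have h1 : ∀ᵐ ω ∂P, ∑ i, θ i (Z ω) = 1 := ae_of_ae_map hZ.aemeasurable hθ1
    have h2 : ∀ᵐ ω ∂P, U ω ∈ Ioc (0 : ℝ) 1 := by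
      refine ae_of_ae_map hUm.aemeasurable ?_
      rw [hUlaw, ← Measure.restrict_congr_set Ioc_ae_eq_Icc]
      exact ae_restrict_mem measurableSet_Ioc
    filter_upwards [h1, h2] with ω hω1 hω2
    have h3 : ∀ i : Fin n, ((fun ω => (Z ω, U ω)) ⁻¹' C i).indicator (fun _ => (1 : ℝ)) ω
        = (fun j : ℕ => (Ici (U ω)).indicator (fun _ => (1 : ℝ)) (S (j + 1) (Z ω))
          - (Ici (U ω)).indicator (fun _ => (1 : ℝ)) (S j (Z ω))) i := by
      intro i
      have hle : S i (Z ω) ≤ S (i + 1) (Z ω) := by rw [hSs]; linarith [hθ0 i (Z ω)]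
      simp only [indicator, mem_preimage, hC, mem_ofPred_eq, mem_Ioc, mem_Ici]
      rcases lt_or_ge (S i (Z ω)) (U ω) with h | h
      · simp [h, h.not_ge]
      · simp [h, h.not_gt, h.trans hle]
    rw [Finset.sum_congr rfl fun i _ => h3 i,
      Fin.sum_univ_eq_sum_range (fun j : ℕ => (Ici (U ω)).indicator (fun _ => (1 : ℝ))
        (S (j + 1) (Z ω)) - (Ici (U ω)).indicator (fun _ => (1 : ℝ)) (S j (Z ω))) n,
      Finset.sum_range_sub (fun j : ℕ => (Ici (U ω)).indicator (fun _ => (1 : ℝ)) (S j (Z ω))),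
      hS0, hSn, hω1, indicator_of_mem (by exact hω2.2),
      indicator_of_notMem (by simpa using hω2.1), sub_zero]
  · have hpre : Z ⁻¹' s ∩ (fun ω => (Z ω, U ω)) ⁻¹' C i
        = (fun ω => (Z ω, U ω)) ⁻¹' (s ×ˢ univ ∩ C i) := by
      ext ω; simp
    rw [hpre, ← Measure.map_apply hZU ((hs.prod MeasurableSet.univ).inter (hCm i)),
      (indepFun_iff_map_prod_eq_prod_map_map hZ.aemeasurable hUm.aemeasurable).1 hUZ.symm,
      Measure.prod_apply ((hs.prod MeasurableSet.univ).inter (hCm i)), ← hθ i s hs,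
      ← lintegral_indicator hs]
    refine lintegral_congr_ae ?_
    filter_upwards [hθ1] with z hz
    by_cases hzs : z ∈ s
    · have h4 : Prod.mk z ⁻¹' (s ×ˢ univ ∩ C i) = Ioc (S i z) (S (i + 1) z) := by
        ext u; simp [hC, hzs]
      rw [h4, indicator_of_mem hzs, hUlaw, Measure.restrict_apply measurableSet_Ioc,
        inter_eq_left.2, Real.volume_Ioc, hSs, add_sub_cancel_left]
      exact Ioc_subset_Icc_self.trans (Icc_subset_Icc (hSnn _ _) ((hSle _ _).trans hz.le))
    · have h4 : Prod.mk z ⁻¹' (s ×ˢ univ ∩ C i) = ∅ := by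
        ext u; simp [hzs]
      rw [h4, indicator_of_notMem hzs, measure_empty]

/-- Monotone splits of the tail function of a law come from a decomposition of the law. -/
theorem exists_measures_of_monotone_splits {n : ℕ} {μ : Measure ℝ} [IsProbabilityMeasure μ]
    {M : ℝ} (hμ : μ (Iic M) = 1) {x : ℝ → Fin n → ℝ} (hxm : MonotoneOn x (Icc 0 1))
    (hx : ∀ p ∈ Icc (0 : ℝ) 1, x p ∈ splits n p) :
    ∃ m : Fin n → Measure ℝ, ∑ i, m i = μ ∧
      ∀ i y, m i (Ioi y) = ENNReal.ofReal (x (μ.real (Ioi y)) i) := by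
  -- Coordinate increments are nonnegative and add up to `q - p`, so each is at most `q - p`. The
  -- resulting continuity of `x` makes the functions `F i` below right-continuous.
  have hlip : ∀ i, ∀ p ∈ Icc (0 : ℝ) 1, ∀ q ∈ Icc (0 : ℝ) 1, p ≤ q → x q i - x p i ≤ q - p := by
    intro i p hp q hq hpq
    have h1 : ∑ j, (x q j - x p j) = q - p := by
      rw [Finset.sum_sub_distrib, (hx q hq).2, (hx p hp).2]
    rw [← h1]
    exact Finset.single_le_sum (f := fun j => x q j - x p j)
      (fun j _ => sub_nonneg.2 (hxm hp hq hpq j)) (Finset.mem_univ i)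
  have hcont : ∀ i, ContinuousOn (fun p => x p i) (Icc 0 1) := by
    intro i
    refine LipschitzOnWith.continuousOn (K := 1) (LipschitzOnWith.of_dist_le_mul ?_)
    intro p hp q hq
    rw [NNReal.coe_one, one_mul, Real.dist_eq, Real.dist_eq]
    rcases le_total p q with h | h
    · rw [abs_sub_comm, abs_sub_comm p, abs_of_nonneg (sub_nonneg.2 (hxm hp hq h i)),
        abs_of_nonneg (sub_nonneg.2 h)]
      exact hlip i p hp q hq h
    · rw [abs_of_nonneg (sub_nonneg.2 (hxm hq hp h i)), abs_of_nonneg (sub_nonneg.2 h)]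
      exact hlip i q hq p hp h
  have hG : ∀ y, 1 - cdf μ y ∈ Icc (0 : ℝ) 1 := fun y =>
    ⟨sub_nonneg.2 (cdf_le_one μ y), sub_le_self _ (cdf_nonneg μ y)⟩
  have hGr : ∀ y, μ.real (Ioi y) = 1 - cdf μ y := fun y => by
    rw [cdf_eq_real, ← compl_Iic, probReal_compl_eq_one_sub measurableSet_Iic]
  have hGc : ∀ y, ContinuousWithinAt (fun y => 1 - cdf μ y) (Ici y) y := fun y =>
    ContinuousWithinAt.sub (f := fun _ => (1 : ℝ)) continuousWithinAt_const
      ((cdf μ).right_continuous y)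
  let F : Fin n → StieltjesFunction ℝ := fun i =>
    { toFun := fun y => -x (1 - cdf μ y) i
      mono' := fun a b hab => neg_le_neg
        (hxm (hG b) (hG a) (sub_le_sub_left (monotone_cdf μ hab) _) i)
      right_continuous' := fun y =>
        ((hcont i _ (hG y)).comp (f := fun y => 1 - cdf μ y) (hGc y) fun z _ => hG z).neg }
  have hF : ∀ i y, F i y = -x (1 - cdf μ y) i := fun _ _ => rfl
  refine ⟨fun i => (F i).measure, ?_, fun i y => ?_⟩
  · symm
    refine Measure.ext_of_Ioc _ _ fun a b hab => ?_
    rw [Measure.finsetSum_apply]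
    simp only [StieltjesFunction.measure_Ioc]
    rw [← ENNReal.ofReal_sum_of_nonneg fun i _ => sub_nonneg.2 ((F i).mono hab.le),
      Finset.sum_sub_distrib]
    simp only [hF, Finset.sum_neg_distrib, (hx _ (hG _)).2]
    rw [show -(1 - cdf μ b) - -(1 - cdf μ a) = cdf μ b - cdf μ a by ring,
      ← StieltjesFunction.measure_Ioc, measure_cdf]
  · have hx0 : x 0 i = 0 := by
      have h0 := hx 0 ⟨le_rfl, zero_le_one⟩
      exact (Finset.sum_eq_zero_iff_of_nonneg fun i _ => (h0.1 i).1).1 h0.2 i (Finset.mem_univ i)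
    have hlim : Filter.Tendsto (F i) Filter.atTop (nhds 0) := by
      refine tendsto_const_nhds.congr' ?_
      filter_upwards [Filter.eventually_ge_atTop M] with y hy
      have : cdf μ y = 1 := by
        refine le_antisymm (cdf_le_one μ y) ?_
        have h1 : cdf μ M = 1 := by rw [cdf_eq_real, measureReal_def, hμ, ENNReal.toReal_one]
        rw [← h1]
        exact monotone_cdf μ hy
      rw [hF, this, sub_self, hx0, neg_zero]
    rw [StieltjesFunction.measure_Ioi _ hlim, hF, hGr, zero_sub, neg_neg]

/-- Assigning the whole payoff to one agent at a time attains the Choquet integral with respect to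
the sup-convolution. -/
theorem exists_allocation_of_supConv {n : ℕ} (hn : 1 ≤ n) {k : Fin n → ℝ → ℝ}
    (hk : ∀ i, ConcaveOn ℝ (Icc 0 1) (k i)) (hkc : ∀ i, ContinuousOn (k i) (Icc 0 1))
    (hkm : ∀ i, MonotoneOn (k i) (Icc 0 1)) (hk0 : ∀ i, k i 0 = 0) {Z U : Ω → ℝ} {M : ℝ}
    (hZ : Measurable Z) (hZ0 : ∀ ω, 0 ≤ Z ω) (hZM : ∀ ω, Z ω ≤ M) (hUm : Measurable U)
    (hU : pdf.IsUniform U (Icc (0 : ℝ) 1) P volume) (hUZ : IndepFun U Z P) :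
    ∃ Y : Fin n → Ω → ℝ, (∀ i, Measurable (Y i)) ∧ (∀ i ω, 0 ≤ Y i ω) ∧ (∀ i ω, Y i ω ≤ M) ∧
      (∀ᵐ ω ∂P, ∑ i, Y i ω = Z ω) ∧
      choquet P (supConv k) Z = ∑ i, choquet P (k i) (Y i) := by
  have hM : 0 ≤ M := by
    obtain ⟨ω⟩ : Nonempty Ω := P.nonempty_of_neZero
    exact (hZ0 ω).trans (hZM ω)
  have hsub : Icc (0 : ℝ) 1 ⊆ Icc (0 : ℝ) n := Icc_subset_Icc_right (by exact_mod_cast hn)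
  have hprob : IsProbabilityMeasure (P.map Z) := Measure.isProbabilityMeasure_map hZ.aemeasurable
  obtain ⟨x, hxm, hx⟩ := exists_monotone_optimalSplits hn hk hkc
  have hμ : P.map Z (Iic M) = 1 := by
    rw [Measure.map_apply hZ measurableSet_Iic]
    have : Z ⁻¹' Iic M = univ := eq_univ_of_forall hZM
    simp [this]
  obtain ⟨m, hmsum, hm⟩ := exists_measures_of_monotone_splits hμ (hxm.mono hsub)
    fun p hp => (hx p (hsub hp)).1
  obtain ⟨A, hAm, hA1, hA⟩ := exists_partition_of_sum_eq_map hZ hUm hU hUZ hmsum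
  have hYM : ∀ i ω, (A i).indicator Z ω ≤ M := fun i ω =>
    (indicator_le_self' (fun ω _ => hZ0 ω) ω).trans (hZM ω)
  -- For `y > 0` the share of agent `i` exceeds `y` exactly on `{Z > y} ∩ A i`, whose probability is
  -- the `i`-th coordinate of the optimal split of `P(Z > y)`.
  refine ⟨fun i => (A i).indicator Z, fun i => hZ.indicator (hAm i),
    fun i ω => indicator_nonneg (fun ω _ => hZ0 ω) ω, hYM, ?_, ?_⟩
  · filter_upwards [hA1] with ω hω
    have : ∀ i, (A i).indicator Z ω = (A i).indicator (fun _ => (1 : ℝ)) ω * Z ω := fun i => by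
      by_cases h : ω ∈ A i <;> simp [h]
    simp only [this]
    rw [← Finset.sum_mul, hω, one_mul]
  · have hpos : ∀ i, ∀ y ∈ Ioc 0 M, P.real {ω | y < (A i).indicator Z ω}
        = x (P.real {ω | y < Z ω}) i := by
      intro i y hy
      have h1 : {ω | y < (A i).indicator Z ω} = Z ⁻¹' Ioi y ∩ A i := by
        ext ω
        by_cases h : ω ∈ A i
        · simp [h]
        · simp [h, hy.1.le]
      have h2 : (P.map Z).real (Ioi y) = P.real {ω | y < Z ω} :=
        map_measureReal_apply hZ measurableSet_Ioi
      rw [h1, measureReal_def, hA i _ measurableSet_Ioi, hm, h2, ENNReal.toReal_ofReal]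
      exact ((hx _ (hsub ⟨measureReal_nonneg, measureReal_le_one⟩)).1.1 i).1
    rw [choquet_eq_setIntegral (supConv_zero hk0) hZM,
      Finset.sum_congr rfl fun i _ => choquet_eq_setIntegral (hk0 i) (hYM i),
      ← integral_finsetSum _ fun i _ => integrableOn_comp_measureReal_ge (hkm i) _ _ _]
    refine integral_congr_ae ?_
    filter_upwards [meas_le_ae_eq_meas_lt P (volume.restrict (Ioc 0 M)) Z,
      ae_all_iff.2 fun i =>
        meas_le_ae_eq_meas_lt P (volume.restrict (Ioc 0 M)) ((A i).indicator Z),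
      ae_restrict_mem measurableSet_Ioc] with y hy1 hy2 hy3
    have e1 : P.real {ω | y ≤ Z ω} = P.real {ω | y < Z ω} := by
      simp only [measureReal_def, hy1]
    have e2 : ∀ i, P.real {ω | y ≤ (A i).indicator Z ω} = x (P.real {ω | y < Z ω}) i := by
      intro i
      rw [← hpos i y hy3]
      simp only [measureReal_def, hy2 i]
    simp only [e1, e2]
    exact supConv_eq_of_mem (hx _ (hsub ⟨measureReal_nonneg, measureReal_le_one⟩))

end RandomizedAllocation

/-! ### The scalar problem for the proportion. -/

section OptimalProportion

section UnitInv

variable {f : ℝ → ℝ} {y : ℝ}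

theorem isLUB_unitInv (f : ℝ → ℝ) (y : ℝ) :
    IsLUB (insert 0 {t : ℝ | t ∈ Ioo (0 : ℝ) 1 ∧ f t ≤ y}) (unitInv f y) := by
  refine isLUB_csSup ⟨0, mem_insert _ _⟩ ⟨1, ?_⟩
  rintro t (rfl | ht)
  · exact zero_le_one
  · exact ht.1.2.le

theorem unitInv_mem_Icc (f : ℝ → ℝ) (y : ℝ) : unitInv f y ∈ Icc (0 : ℝ) 1 := by
  refine ⟨(isLUB_unitInv f y).1 (mem_insert _ _), (isLUB_unitInv f y).2 ?_⟩
  rintro t (rfl | ht)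
  · exact zero_le_one
  · exact ht.1.2.le

theorem le_unitInv {t : ℝ} (ht : t ∈ Ioo (0 : ℝ) 1) (hty : f t ≤ y) : t ≤ unitInv f y :=
  (isLUB_unitInv f y).1 (Or.inr ⟨ht, hty⟩)

theorem le_of_lt_unitInv (hf : MonotoneOn f (Ioo 0 1)) {t : ℝ} (ht0 : 0 < t)
    (ht : t < unitInv f y) : f t ≤ y := by
  obtain ⟨s, hs, hts⟩ := (lt_isLUB_iff (isLUB_unitInv f y)).1 ht
  rcases hs with rfl | hs
  · exact absurd ht0 hts.not_gt
  · exact (hf ⟨ht0, hts.trans hs.1.2⟩ hs.1 hts.le).trans hs.2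

theorem le_iff_le_unitInv (hf : MonotoneOn f (Icc 0 1)) (hfc : ContinuousOn f (Icc 0 1))
    (h0 : f 0 ≤ y) {t : ℝ} (ht : t ∈ Icc (0 : ℝ) 1) : f t ≤ y ↔ t ≤ unitInv f y := by
  constructor
  · intro hty
    refine le_of_forall_lt fun s hs => ?_
    rcases lt_or_ge s 0 with hs0 | hs0
    · exact hs0.trans_le (unitInv_mem_Icc f y).1
    -- The midpoint lies in the open interval used by `unitInv` even when `t = 1`.
    · have hu : (s + t) / 2 ∈ Ioo (0 : ℝ) 1 := ⟨by linarith, by linarith [ht.2]⟩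
      have := le_unitInv hu ((hf (Ioo_subset_Icc_self hu) ht (by linarith)).trans hty)
      linarith
  · intro htb
    have hcl : IsClosed (Icc (0 : ℝ) 1 ∩ f ⁻¹' Iic y) :=
      hfc.preimage_isClosed_of_isClosed isClosed_Icc isClosed_Iic
    have hsub : insert 0 {t : ℝ | t ∈ Ioo (0 : ℝ) 1 ∧ f t ≤ y} ⊆ Icc (0 : ℝ) 1 ∩ f ⁻¹' Iic y := by
      rintro s (rfl | hs)
      · exact ⟨⟨le_rfl, zero_le_one⟩, h0⟩
      · exact ⟨Ioo_subset_Icc_self hs.1, hs.2⟩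
    have hmem := closure_minimal hsub hcl
      ((isLUB_unitInv f y).mem_closure ⟨0, mem_insert _ _⟩)
    exact (hf ht hmem.1 htb).trans hmem.2

end UnitInv

/-- The maximizers of `t ↦ t * r - c t` under the constraint `c t ≤ W`. -/
def netGainMaximizers (c : ℝ → ℝ) (W r : ℝ) : Set ℝ :=
  {t | t ∈ Icc (0 : ℝ) 1 ∧ c t ≤ W ∧ ∀ s ∈ Icc (0 : ℝ) 1, c s ≤ W → s * r - c s ≤ t * r - c t}

section Maximizers

variable {c : ℝ → ℝ} {W r : ℝ}

/-- The gain has derivative `r - c'`, nonnegative before `a` and negative after it by the choice of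
`a` as a supremum; strict decrease beyond `a` is what makes the candidate the largest maximizer. The
constraint `c t ≤ W` amounts to `t ≤ b`. -/
theorem isGreatest_netGainMaximizers (hc_mono : MonotoneOn c (Icc 0 1))
    (hc_conv : ConvexOn ℝ (Icc 0 1) c) (hc_cont : ContinuousOn c (Icc 0 1))
    (hc_diff : DifferentiableOn ℝ c (Ioo 0 1)) (hW : c 0 ≤ W) :
    IsGreatest (netGainMaximizers c W r) (min (unitInv (deriv c) r) (unitInv c W)) := by
  set a := unitInv (deriv c) r
  set b := unitInv c W
  have ha : a ∈ Icc (0 : ℝ) 1 := unitInv_mem_Icc _ _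
  have hb : b ∈ Icc (0 : ℝ) 1 := unitInv_mem_Icc _ _
  have hdiff : ∀ x ∈ Ioo (0 : ℝ) 1, DifferentiableAt ℝ c x := fun x hx =>
    hc_diff.differentiableAt (Ioo_mem_nhds hx.1 hx.2)
  have hdm : MonotoneOn (deriv c) (Ioo 0 1) :=
    (hc_conv.subset Ioo_subset_Icc_self (convex_Ioo 0 1)).monotoneOn_deriv hdiff
  have hcont : ContinuousOn (fun t => t * r - c t) (Icc 0 1) :=
    (continuousOn_id.mul continuousOn_const).sub hc_cont
  have hder : ∀ x ∈ Ioo (0 : ℝ) 1, HasDerivAt (fun t => t * r - c t) (r - deriv c x) x := by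
    intro x hx
    have h1 : HasDerivAt (fun t : ℝ => t * r) r x := by
      simpa using (hasDerivAt_id x).mul_const r
    exact h1.fun_sub (hdiff x hx).hasDerivAt
  have hup : MonotoneOn (fun t => t * r - c t) (Icc 0 a) := by
    refine monotoneOn_of_deriv_nonneg (convex_Icc 0 a)
      (hcont.mono (Icc_subset_Icc_right ha.2)) ?_ ?_ <;> rw [interior_Icc] <;> intro x hx
    · exact (hder x ⟨hx.1, hx.2.trans_le ha.2⟩).differentiableAt.differentiableWithinAt
    · rw [(hder x ⟨hx.1, hx.2.trans_le ha.2⟩).deriv]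
      exact sub_nonneg.2 (le_of_lt_unitInv hdm hx.1 hx.2)
  have hdown : StrictAntiOn (fun t => t * r - c t) (Icc a 1) := by
    refine strictAntiOn_of_deriv_neg (convex_Icc a 1)
      (hcont.mono (Icc_subset_Icc_left ha.1)) ?_
    rw [interior_Icc]
    intro x hx
    have hx' : x ∈ Ioo (0 : ℝ) 1 := ⟨ha.1.trans_lt hx.1, hx.2⟩
    rw [(hder x hx').deriv, sub_neg]
    by_contra! h
    exact absurd (le_unitInv hx' h) hx.1.not_ge
  have hfeas : ∀ {t}, t ∈ Icc (0 : ℝ) 1 → (c t ≤ W ↔ t ≤ b) := fun ht =>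
    le_iff_le_unitInv hc_mono hc_cont hW ht
  have hab : min a b ∈ Icc (0 : ℝ) 1 := ⟨le_min ha.1 hb.1, (min_le_left _ _).trans ha.2⟩
  refine ⟨⟨hab, (hfeas hab).2 (min_le_right _ _), fun s hs hsW => ?_⟩, fun s hs => ?_⟩
  · have hsb := (hfeas hs).1 hsW
    rcases le_or_gt s a with hsa | hsa
    · exact hup ⟨hs.1, hsa⟩ ⟨hab.1, min_le_left _ _⟩ (le_min hsa hsb)
    · rw [min_eq_left (hsa.le.trans hsb)]
      exact hdown.antitoneOn ⟨le_rfl, ha.2⟩ ⟨hsa.le, hs.2⟩ hsa.le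
  · have hsb := (hfeas hs.1).1 hs.2.1
    refine le_min ?_ hsb
    by_contra! hsa
    have h1 := hs.2.2 a ha ((hfeas ha).2 (hsa.le.trans hsb))
    exact absurd (hdown ⟨le_rfl, ha.2⟩ ⟨hsa.le, hs.1.2⟩ hsa) h1.not_gt

theorem subsingleton_netGainMaximizers (hc : StrictConvexOn ℝ (Icc 0 1) c) :
    (netGainMaximizers c W r).Subsingleton := by
  intro s hs t ht
  by_contra hne
  have hm := hc.2 hs.1 ht.1 hne (by norm_num : (0 : ℝ) < 1 / 2) (by norm_num : (0 : ℝ) < 1 / 2)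
    (by norm_num)
  have hmem : (1 / 2 : ℝ) • s + (1 / 2 : ℝ) • t ∈ Icc (0 : ℝ) 1 :=
    convex_Icc 0 1 hs.1 ht.1 (by norm_num) (by norm_num) (by norm_num)
  simp only [smul_eq_mul] at hm hmem
  have h1 := hs.2.2 _ hmem (by linarith [hs.2.1, ht.2.1])
  have h2 := ht.2.2 _ hmem (by linarith [hs.2.1, ht.2.1])
  linarith

end Maximizers

/-! ### Reduction of the portfolio problem to the scalar problem. -/

variable {Ω : Type*} [MeasurableSpace Ω] {P : Measure Ω}

/-- The two hypotheses identify the least aggregate risk at each `t`, and it is attained; `B > 0`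
only rescales the objective. -/
theorem optimalProportions_eq_netGainMaximizers {n : ℕ} {h : Fin n → ℝ → ℝ} {X : Ω → ℝ}
    {c : ℝ → ℝ} {W r B : ℝ} (hB : 0 < B)
    (hlower : ∀ (t : ℝ) (Y : Fin n → Ω → ℝ), IsFeasible P X c W t Y →
      -(B * (W - c t + t * r)) ≤ aggregateRisk P h Y)
    (hattained : ∀ t ∈ Icc (0 : ℝ) 1, c t ≤ W → ∃ Y : Fin n → Ω → ℝ, IsFeasible P X c W t Y ∧
      aggregateRisk P h Y ≤ -(B * (W - c t + t * r))) :
    optimalProportions P h X c W = netGainMaximizers c W r := by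
  ext t
  constructor
  · rintro ⟨Y, hY, hmin⟩
    refine ⟨hY.proportion_mem, hY.cost_le, fun s hs hsW => ?_⟩
    obtain ⟨Z, hZ, hZle⟩ := hattained s hs hsW
    have h1 := (hlower t Y hY).trans ((hmin s Z hZ).trans hZle)
    have h2 := le_of_mul_le_mul_left (neg_le_neg_iff.1 h1) hB
    linarith
  · rintro ⟨ht, htW, hmax⟩
    obtain ⟨Y, hY, hYle⟩ := hattained t ht htW
    refine ⟨Y, hY, fun s Z hZ => hYle.trans (le_trans ?_ (hlower s Z hZ))⟩
    have h1 := hmax s hZ.proportion_mem hZ.cost_le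
    exact neg_le_neg (mul_le_mul_of_nonneg_left (by linarith) hB.le)

/-- Passes from almost sure bounds to the pointwise ones required above, by truncating a measurable
version. -/
theorem exists_bounded_representative [IsProbabilityMeasure P] {Y : Ω → ℝ} (hY : Y ∈ LPlus P) :
    ∃ (Z : Ω → ℝ) (M : ℝ), Measurable Z ∧ (∀ ω, 0 ≤ Z ω) ∧ (∀ ω, Z ω ≤ M) ∧ Y =ᵐ[P] Z := by
  obtain ⟨⟨hYm, hYb⟩, hY0⟩ := hY
  set C := (eLpNorm Y ⊤ P).toReal with hC
  have hbound : ∀ᵐ ω ∂P, Y ω ≤ C := by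
    have h1 : ∀ᵐ ω ∂P, ‖Y ω‖ₑ ≤ eLpNormEssSup Y P := enorm_ae_le_eLpNormEssSup Y P
    filter_upwards [h1] with ω hω
    rw [← eLpNorm_exponent_top] at hω
    have h2 := ENNReal.toReal_mono hYb.ne hω
    rw [toReal_enorm] at h2
    exact (le_abs_self _).trans h2
  have hC0 : 0 ≤ C := ENNReal.toReal_nonneg
  refine ⟨fun ω => max 0 (min (hYm.mk Y ω) C), C,
    measurable_const.max ((hYm.stronglyMeasurable_mk.measurable).min measurable_const),
    fun ω => le_max_left _ _, fun ω => max_le hC0 (min_le_right _ _), ?_⟩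
  filter_upwards [hYm.ae_eq_mk, hY0, hbound] with ω h1 h2 h3
  rw [← h1, min_eq_left h3]
  exact (max_eq_right h2).symm

theorem mem_LPlus_of_bounded [IsProbabilityMeasure P] {Y : Ω → ℝ} {M : ℝ} (hY : Measurable Y)
    (hY0 : ∀ ω, 0 ≤ Y ω) (hYM : ∀ ω, Y ω ≤ M) : Y ∈ LPlus P :=
  ⟨MemLp.of_bound hY.aestronglyMeasurable M (Filter.Eventually.of_forall fun ω => by
    rw [Real.norm_of_nonneg (hY0 ω)]; exact hYM ω), Filter.Eventually.of_forall hY0⟩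

/-- If `choquet P K` is the largest aggregate Choquet integral of the allocations of any wealth
profile, then the optimal proportions maximize the net gain with expected return given by `K`. -/
theorem optimalProportions_eq_of_choquet [IsProbabilityMeasure P] {n : ℕ} {h : Fin n → ℝ → ℝ}
    (hh : ∀ i, IsDistortion (h i)) {X X' : Ω → ℝ} (hXX' : X =ᵐ[P] X')
    (hX0 : ∀ ω, 0 ≤ X' ω) {MX : ℝ} (hXM : ∀ ω, X' ω ≤ MX) {c : ℝ → ℝ} {W : ℝ} {K : ℝ → ℝ}
    (hKm : MonotoneOn K (Icc 0 1)) (hK0 : K 0 = 0) (hK1 : 0 < K 1)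
    (hupper : ∀ (Y : Fin n → Ω → ℝ) (M : ℝ), (∀ i, Measurable (Y i)) → (∀ i ω, 0 ≤ Y i ω) →
      (∀ i ω, Y i ω ≤ M) →
      ∑ i, choquet P (dual (h i)) (Y i) ≤ choquet P K (fun ω => ∑ i, Y i ω))
    (hattained : ∀ a t : ℝ, 0 ≤ a → 0 ≤ t → ∃ (Y : Fin n → Ω → ℝ) (M : ℝ),
      (∀ i, Measurable (Y i)) ∧ (∀ i ω, 0 ≤ Y i ω) ∧ (∀ i ω, Y i ω ≤ M) ∧
      (∀ᵐ ω ∂P, ∑ i, Y i ω = a + t * X' ω) ∧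
      choquet P K (fun ω => a + t * X' ω) ≤ ∑ i, choquet P (dual (h i)) (Y i)) :
    optimalProportions P h X c W
      = netGainMaximizers c W (riskmetric P (fun x => K x / K 1) X) := by
  have hr : riskmetric P (fun x => K x / K 1) X = choquet P K X' / K 1 := by
    rw [riskmetric_congr hXX', riskmetric_eq_choquet hX0, choquet_div_const]
  have hval : ∀ t, t ∈ Icc (0 : ℝ) 1 → c t ≤ W →
      choquet P K (fun ω => (W - c t) + t * X' ω)
        = K 1 * (W - c t + t * riskmetric P (fun x => K x / K 1) X) := by
    intro t ht htW
    rw [choquet_add_mul hKm hK0 hX0 hXM (sub_nonneg.2 htW) ht.1, hr]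
    field_simp
  have hagg : ∀ Y : Fin n → Ω → ℝ, (∀ i, Measurable (Y i)) → (∀ i ω, 0 ≤ Y i ω) →
      aggregateRisk P h Y = -∑ i, choquet P (dual (h i)) (Y i) := by
    intro Y hYm hY0
    rw [aggregateRisk, ← Finset.sum_neg_distrib]
    exact Finset.sum_congr rfl fun i _ => riskmetric_neg_eq (hh i).map_zero (hYm i) (hY0 i)
  refine optimalProportions_eq_netGainMaximizers hK1 (fun t Y hY => ?_) fun t ht htW => ?_
  · choose Y' M hYm hY0 hYM hYY' using fun i => exists_bounded_representative (hY.mem_LPlus i)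
    have hYM' : ∀ i ω, Y' i ω ≤ ∑ j, |M j| := fun i ω => (hYM i ω).trans ((le_abs_self _).trans
      (Finset.single_le_sum (f := fun j => |M j|) (fun _ _ => abs_nonneg _) (Finset.mem_univ i)))
    have h1 : aggregateRisk P h Y = aggregateRisk P h Y' :=
      Finset.sum_congr rfl fun i _ => riskmetric_congr
        ((hYY' i).mono fun ω hω => by simp only [hω]) _
    have h2 : (fun ω => ∑ i, Y' i ω) =ᵐ[P] fun ω => (W - c t) + t * X' ω := by
      filter_upwards [ae_all_iff.2 hYY', hY.sum_eq, hXX'] with ω e1 e2 e3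
      simp only [← e1, e2, e3]
      ring
    rw [h1, hagg Y' hYm hY0, ← hval t hY.proportion_mem hY.cost_le, ← choquet_congr h2]
    exact neg_le_neg (hupper Y' _ hYm hY0 hYM')
  · obtain ⟨Y, M, hYm, hY0, hYM, hsum, hle⟩ := hattained (W - c t) t (sub_nonneg.2 htW) ht.1
    refine ⟨Y, ⟨ht, htW, fun i => mem_LPlus_of_bounded (hYm i) (hY0 i) (hYM i), ?_⟩, ?_⟩
    · filter_upwards [hsum, hXX'] with ω e1 e2
      rw [e1, e2]
      ring
    · rw [hagg Y hYm hY0, ← hval t ht htW]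
      exact neg_le_neg hle

section Dual

variable {h : ℝ → ℝ}

theorem one_sub_mem_Icc {t : ℝ} (ht : t ∈ Icc (0 : ℝ) 1) : 1 - t ∈ Icc (0 : ℝ) 1 :=
  ⟨by linarith [ht.2], by linarith [ht.1]⟩

theorem dual_zero (h : ℝ → ℝ) : dual h 0 = 0 := by simp [dual]

theorem IsDistortion.dual_one (hh : IsDistortion h) : dual h 1 = 1 := by
  simp [dual, hh.map_zero, hh.map_one]

theorem IsDistortion.monotoneOn_dual (hh : IsDistortion h) : MonotoneOn (dual h) (Icc 0 1) :=
  fun _ hs _ ht hst => sub_le_sub_left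
    (hh.monotoneOn (one_sub_mem_Icc ht) (one_sub_mem_Icc hs) (by linarith)) _

theorem convexOn_dual (hh : ConcaveOn ℝ (Icc 0 1) h) : ConvexOn ℝ (Icc 0 1) (dual h) := by
  refine ⟨convex_Icc 0 1, fun x hx y hy a b ha hb hab => ?_⟩
  have h1 := hh.2 (one_sub_mem_Icc hx) (one_sub_mem_Icc hy) ha hb hab
  have h2 : a • (1 - x) + b • (1 - y) = 1 - (a • x + b • y) := by
    simp only [smul_eq_mul]; linear_combination hab
  rw [h2] at h1
  simp only [dual, smul_eq_mul] at h1 ⊢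
  have h3 : a * h 1 + b * h 1 = h 1 := by rw [← add_mul, hab, one_mul]
  linarith

theorem concaveOn_dual (hh : ConvexOn ℝ (Icc 0 1) h) : ConcaveOn ℝ (Icc 0 1) (dual h) := by
  refine ⟨convex_Icc 0 1, fun x hx y hy a b ha hb hab => ?_⟩
  have h1 := hh.2 (one_sub_mem_Icc hx) (one_sub_mem_Icc hy) ha hb hab
  have h2 : a • (1 - x) + b • (1 - y) = 1 - (a • x + b • y) := by
    simp only [smul_eq_mul]; linear_combination hab
  rw [h2] at h1
  simp only [dual, smul_eq_mul] at h1 ⊢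
  have h3 : a * h 1 + b * h 1 = h 1 := by rw [← add_mul, hab, one_mul]
  linarith

theorem continuousOn_dual (hh : ContinuousOn h (Icc 0 1)) : ContinuousOn (dual h) (Icc 0 1) :=
  continuousOn_const.sub (hh.comp (by fun_prop) fun _ ht => one_sub_mem_Icc ht)

end Dual

section IInf

variable {n : ℕ} {h : Fin n → ℝ → ℝ}

theorem iInf_le_of_fin (h : Fin n → ℝ → ℝ) (i : Fin n) (x : ℝ) : ⨅ j, h j x ≤ h i x :=
  ciInf_le (Set.finite_range _).bddBelow i

theorem exists_eq_iInf_of_fin (hn : 1 ≤ n) (h : Fin n → ℝ → ℝ) (x : ℝ) :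
    ∃ i, h i x = ⨅ j, h j x := by
  have : Nonempty (Fin n) := ⟨⟨0, hn⟩⟩
  exact exists_eq_ciInf_of_finite

theorem IsDistortion.iInf (hn : 1 ≤ n) (hh : ∀ i, IsDistortion (h i)) :
    IsDistortion fun x => ⨅ i, h i x := by
  have : Nonempty (Fin n) := ⟨⟨0, hn⟩⟩
  refine ⟨fun x hx y hy hxy => ?_, ?_, ?_⟩
  · exact le_ciInf fun i => (iInf_le_of_fin h i x).trans ((hh i).monotoneOn hx hy hxy)
  · simp [(hh _).map_zero]
  · simp [(hh _).map_one]

theorem concaveOn_iInf_of_fin (hn : 1 ≤ n) (hh : ∀ i, ConcaveOn ℝ (Icc 0 1) (h i)) :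
    ConcaveOn ℝ (Icc 0 1) fun x => ⨅ i, h i x := by
  have : Nonempty (Fin n) := ⟨⟨0, hn⟩⟩
  refine ⟨convex_Icc 0 1, fun x hx y hy a b ha hb hab => le_ciInf fun i => ?_⟩
  refine le_trans ?_ ((hh i).2 hx hy ha hb hab)
  exact add_le_add (mul_le_mul_of_nonneg_left (iInf_le_of_fin h i x) ha)
    (mul_le_mul_of_nonneg_left (iInf_le_of_fin h i y) hb)

end IInf

/-- The dual of the minimum is the pointwise maximum of the duals, so it dominates each of them and
equals one of them at every point. Its value at `1` is `1`, so no normalization appears. -/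
theorem optimalProportions_eq_of_concaveOn [IsProbabilityMeasure P] {n : ℕ} (hn : 1 ≤ n)
    {h : Fin n → ℝ → ℝ} (hh : ∀ i, IsDistortion (h i)) (hconc : ∀ i, ConcaveOn ℝ (Icc 0 1) (h i))
    {X : Ω → ℝ} (hX : X ∈ LPlus P) (c : ℝ → ℝ) (W : ℝ) :
    optimalProportions P h X c W
      = netGainMaximizers c W (riskmetric P (dual fun x => ⨅ i, h i x) X) := by
  obtain ⟨X', MX, hXm, hX0, hXM, hXX'⟩ := exists_bounded_representative hX
  have hinf : IsDistortion fun x => ⨅ i, h i x := IsDistortion.iInf hn hh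
  set l : ℝ → ℝ := dual fun x => ⨅ i, h i x with hl
  have hl1 : l 1 = 1 := hinf.dual_one
  have hl0 : l 0 = 0 := dual_zero _
  have hlm : MonotoneOn l (Icc 0 1) := hinf.monotoneOn_dual
  have hlc : ConvexOn ℝ (Icc 0 1) l := convexOn_dual (concaveOn_iInf_of_fin hn hconc)
  have hval : ∀ i x, dual (h i) x = 1 - h i (1 - x) := fun i x => by
    rw [dual, (hh i).map_one]
  have hlval : ∀ x, l x = 1 - ⨅ i, h i (1 - x) := fun x => by
    rw [hl, dual, hinf.map_one]
  have key := optimalProportions_eq_of_choquet (c := c) (W := W) hh hXX' hX0 hXM hlm hl0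
    (by rw [hl1]; exact one_pos) ?_ ?_
  · simpa only [hl1, div_one] using key
  · intro Y M hYm hY0 hYM
    refine le_trans (Finset.sum_le_sum fun i _ => ?_)
      (sum_choquet_le_of_convexOn hlc hlm hl0 hl1 hYm hY0 hYM)
    rw [choquet_eq_setIntegral (dual_zero (h i)) (hYM i), choquet_eq_setIntegral hl0 (hYM i)]
    refine integral_mono (integrableOn_comp_measureReal_ge (hh i).monotoneOn_dual _ _ _)
      (integrableOn_comp_measureReal_ge hlm _ _ _) fun y => ?_
    simp only [hval, hlval]
    exact sub_le_sub_left (iInf_le_of_fin h i _) _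
  · intro a t ha ht
    have hZ0 : ∀ ω, 0 ≤ a + t * X' ω := fun ω => add_nonneg ha (mul_nonneg ht (hX0 ω))
    have hZM : ∀ ω, a + t * X' ω ≤ a + t * MX := fun ω =>
      add_le_add_right (mul_le_mul_of_nonneg_left (hXM ω) ht) a
    obtain ⟨Y, hYm, hY0, hYs, hle⟩ := exists_allocation_of_max (P := P)
      (fun i => (hh i).monotoneOn_dual) (fun i => dual_zero (h i)) hlm hl0
      (fun p _ => by
        obtain ⟨i, hi⟩ := exists_eq_iInf_of_fin hn h (1 - p)
        exact ⟨i, by rw [hlval, hval, hi]⟩)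
      ((hXm.const_mul t).const_add a) hZ0 hZM
    refine ⟨Y, a + t * MX, hYm, hY0, fun i ω => ?_, Filter.Eventually.of_forall hYs, hle⟩
    refine le_trans ?_ (hZM ω)
    rw [← hYs ω]
    exact Finset.single_le_sum (f := fun j => Y j ω) (fun j _ => hY0 j ω) (Finset.mem_univ i)

theorem optimalProportions_eq_of_convexOn [IsProbabilityMeasure P] {n : ℕ} (hn : 1 ≤ n)
    {h : Fin n → ℝ → ℝ} (hh : ∀ i, IsDistortion (h i))
    (hconv : ∀ i, ConvexOn ℝ (Icc 0 1) (h i)) (hcont : ∀ i, ContinuousOn (h i) (Icc 0 1))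
    {X : Ω → ℝ} (hX : X ∈ LPlus P) (hXU : AdmitsIndepUniform P X) (c : ℝ → ℝ) (W : ℝ) :
    optimalProportions P h X c W = netGainMaximizers c W (riskmetric P
      (fun x => supConv (fun i => dual (h i)) x / supConv (fun i => dual (h i)) 1) X) := by
  obtain ⟨X', MX, hXm, hX0, hXM, hXX'⟩ := exists_bounded_representative hX
  obtain ⟨U, hUm, hU, hUX⟩ := hXU
  have hUX' : IndepFun U X' P := hUX.congr Filter.EventuallyEq.rfl hXX'
  have hk := fun i => concaveOn_dual (hconv i)
  have hkc := fun i => continuousOn_dual (hcont i)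
  have hkm := fun i => (hh i).monotoneOn_dual
  have hk0 := fun i => dual_zero (h i)
  have hsub : Icc (0 : ℝ) 1 ⊆ Icc (0 : ℝ) n := Icc_subset_Icc_right (by exact_mod_cast hn)
  refine optimalProportions_eq_of_choquet hh hXX' hX0 hXM
    ((monotoneOn_supConv hn hk hkc hkm).mono hsub) (supConv_zero hk0)
    (one_pos.trans_le (one_le_supConv_one hn hkc hk0 fun i => (hh i).dual_one))
    (fun Y M hYm hY0 hYM => sum_choquet_le_supConv hn hk hkc hkm hk0 hYm hY0 hYM) ?_
  intro a t ha ht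
  -- The profile `a + t * X'` is a function of `X'`, hence still independent of `U`.
  obtain ⟨Y, hYm, hY0, hYM, hYs, heq⟩ := exists_allocation_of_supConv (P := P) (U := U) hn hk hkc
    hkm hk0 (M := a + t * MX) ((hXm.const_mul t).const_add a)
    (fun ω => add_nonneg ha (mul_nonneg ht (hX0 ω)))
    (fun ω => add_le_add_right (mul_le_mul_of_nonneg_left (hXM ω) ht) a) hUm hU
    (hUX'.comp measurable_id ((measurable_id.const_mul t).const_add a))
  exact ⟨Y, _, hYm, hY0, hYM, hYs, heq.le⟩

end OptimalProportion

end PortfolioManager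

end

theorem proposition4 {Ω : Type*} [MeasurableSpace Ω] (P : Measure Ω) [IsProbabilityMeasure P]
    (n : ℕ) (hn : 1 ≤ n) (h : Fin n → ℝ → ℝ) (hh : ∀ i, PortfolioManager.IsDistortion (h i))
    (X : Ω → ℝ) (hX : X ∈ PortfolioManager.LPlus P)
    (hXU : PortfolioManager.AdmitsIndepUniform P X)
    (c : ℝ → ℝ) (hc_mono : MonotoneOn c (Icc 0 1)) (hc_conv : ConvexOn ℝ (Icc 0 1) c)
    (hc_cont : ContinuousOn c (Icc 0 1)) (hc_diff : DifferentiableOn ℝ c (Ioo 0 1))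
    (W : ℝ) (hW : c 0 ≤ W) :
    ((∀ i, ConcaveOn ℝ (Icc 0 1) (h i)) →
      let l : ℝ → ℝ := PortfolioManager.dual (fun x => ⨅ i, h i x)
      let t : ℝ := PortfolioManager.proportion P l X c W
      IsGreatest (PortfolioManager.optimalProportions P h X c W) t ∧
        (StrictConvexOn ℝ (Icc 0 1) c →
          PortfolioManager.optimalProportions P h X c W = {t})) ∧
    ((∀ i, ConvexOn ℝ (Icc 0 1) (h i) ∧ ContinuousOn (h i) (Icc 0 1)) →
      let d : Fin n → ℝ → ℝ := fun i => PortfolioManager.dual (h i)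
      let g : ℝ → ℝ := fun x =>
        PortfolioManager.supConv d x / PortfolioManager.supConv d 1
      let t : ℝ := PortfolioManager.proportion P g X c W
      IsGreatest (PortfolioManager.optimalProportions P h X c W) t ∧
        (StrictConvexOn ℝ (Icc 0 1) c →
          PortfolioManager.optimalProportions P h X c W = {t})) := by

  have hgreat : ∀ r, IsGreatest (PortfolioManager.netGainMaximizers c W r)
      (min (PortfolioManager.unitInv (deriv c) r) (PortfolioManager.unitInv c W)) := fun r =>
    PortfolioManager.isGreatest_netGainMaximizers hc_mono hc_conv hc_cont hc_diff hW
  have hunique : ∀ r, StrictConvexOn ℝ (Icc 0 1) c → PortfolioManager.netGainMaximizers c W r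
      = {min (PortfolioManager.unitInv (deriv c) r) (PortfolioManager.unitInv c W)} := fun r hs =>
    (PortfolioManager.subsingleton_netGainMaximizers hs).eq_singleton_of_mem (hgreat r).1
  refine ⟨fun hconc => ?_, fun hconv => ?_⟩
  · rw [PortfolioManager.optimalProportions_eq_of_concaveOn hn hh hconc hX]
    exact ⟨hgreat _, hunique _⟩
  · rw [PortfolioManager.optimalProportions_eq_of_convexOn hn hh (fun i => (hconv i).1)
      (fun i => (hconv i).2) hX hXU]
    exact ⟨hgreat _, hunique _⟩
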